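/- Let $N=\{1,\dots,n\}$, $n\ge 1$, be agents dividing the cake $[0,1]$. Agent $i$ has the single-peaked value density $v_i(x)=\max\{0,\,h_i-k|x-p_i|\}$ on $[0,1]$, with peak $p_i\in[0,1]$, peak density $h_i=v_i(p_i)$, a slope $k>0$ common to all agents, and $\int_0^1 v_i=1$; the peaks $p_1,\dots,p_n$ are pairwise different. Let $U_i\subseteq[0,1]$ be the interval on which $v_i>0$, with endpoints $l_i\le r_i$, and assume that the $U_i$ cover $[0,1]$ up to endpoints, i.e. $\bigcup_i \overline{U_i}=[0,1]$. A piece of cake is a finite union of disjoint subintervals of $[0,1]$, and $V_i(P)=\int_P v_i$. An allocation $X=(X_1,\dots,X_n)$ is a partition of $[0,1]$ into pieces, where $X_i$ goes to agent $i$. An allocation $Y$ Pareto dominates $X$ if $V_i(Y_i)\ge V_i(X_i)$ for all $i$, with strict inequality for some $i$. An allocation is Pareto optimal if no allocation Pareto dominates it, and envy-free if $V_i(X_i)\ge V_i(X_j)$ for all $i,j$. Let $\sigma(1),\dots,\sigma(n)$ be the agents in increasing order of their peaks. The connected allocation with cuts $0=c_0\le c_1\le\dots\le c_n=1$ gives $[0,c_1]$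 to $\sigma(1)$ and $(c_{m-1},c_m]$ to $\sigma(m)$ for $m\ge2$. - *Utilitarian mechanism*: the connected allocation in which, for $m<n$, the cut $c_m$ is the intersection of $v_{\sigma(m)}$ and $v_{\sigma(m+1)}$ between the two peaks, i.e. $p_{\sigma(m)}\le c_m\le p_{\sigma(m+1)}$ and $v_{\sigma(m)}(c_m)=v_{\sigma(m+1)}(c_m)$. - *Leftmost leaves*: the connected allocation in which, for $m=1,\dots,n-1$ in turn, $c_m=\max\{y_m,l_{\sigma(m+1)}\}$, where $y_m\in[c_{m-1},1]$ is the point with $V_{\sigma(m)}([c_{m-1},y_m])=V_{\sigma(m)}([c_{m-1},1])/(n-m+1)$. - *Wang--Wu*: order the points $0,1,l_i,p_i,r_i$ ($i\in N$) increasingly. Each elementary piece between two consecutive distinct points is cut into $2n$ parts of equal length, and for each $j$ agent $j$ gets the $j$-th and the $(2n+1-j)$-th part. - *Modified Wang--Wu*: each elementary piece $[a,b]$ is instead cut into $2n'$ parts of equal length, where $n'$ is the number of agents $i$ with $U_i\cap[a,b]\ne\emptyset$, and the $j$-th of these agents gets the $j$-th and the $(2n'+1-j)$-th part. (In both Wang--Wu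 mechanisms the parts are half-open on the left, except that a part starting at $0$ contains $0$.) Then the cuts of the utilitarian mechanism and of leftmost leaves exist and are unique, the Wang--Wu mechanism gives an allocation, and: 1. The utilitarian mechanism gives a Pareto optimal allocation, and this allocation maximizes $\sum_i V_i(X_i)$ over all allocations. 2. Leftmost leaves gives a Pareto optimal allocation and, if $n\ge2$, it Pareto dominates the Wang--Wu allocation. 3. Modified Wang--Wu gives an envy-free allocation in which every agent is at least as well off as in the Wang--Wu allocation. It Pareto dominates the Wang--Wu allocation if and only if some agent does not value the whole cake, i.e. $l_i>0$ or $r_i<1$ for some $i$. -/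

import Mathlib

open Set MeasureTheory

/-- A cake-cutting problem on `[0, 1]` with agents `Fin n` and single-peaked valuations: the value
density of agent `i` is the tent `x ↦ max 0 (v_i(p_i) - k_i |x - p_i|)` with peak location
`p_i = peak i`, peak density `v_i(p_i) = peakDensity i` and slope `k_i = slope i`. -/
structure CakeProblem (n : ℕ) where
  peak : Fin n → ℝ
  peakDensity : Fin n → ℝ
  slope : Fin n → ℝ
  peak_mem : ∀ i, peak i ∈ Icc (0 : ℝ) 1
  slope_pos : ∀ i, 0 < slope i
  /-- Every agent values the whole cake at `1`. -/
  normalized : ∀ i,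
    ∫ x in Icc (0 : ℝ) 1, max 0 (peakDensity i - slope i * |x - peak i|) = 1
  /-- The whole cake is desired: the intervals on which the agents have positive density cover
  the cake, up to endpoints of these intervals. -/
  covered : Icc (0 : ℝ) 1 ⊆
    ⋃ i, closure {x ∈ Icc (0 : ℝ) 1 | 0 < max 0 (peakDensity i - slope i * |x - peak i|)}

/-- A piece of cake: the union of a finite set of disjoint subintervals of `[0, 1]`. -/
def IsPiece (S : Set ℝ) : Prop :=
  ∃ F : Set (Set ℝ), F.Finite ∧ F.PairwiseDisjoint id ∧
    (∀ I ∈ F, I.OrdConnected ∧ I ⊆ Icc (0 : ℝ) 1) ∧ S = ⋃₀ F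

/-- An allocation: a partition of the cake into one piece for each agent. -/
def IsAllocation {n : ℕ} (X : Fin n → Set ℝ) : Prop :=
  (∀ i, IsPiece (X i)) ∧ Pairwise (fun i j => Disjoint (X i) (X j)) ∧ ⋃ i, X i = Icc (0 : ℝ) 1

namespace CakeProblem

variable {n : ℕ} (P : CakeProblem n)

/-- The value density `v_i`. -/
noncomputable def density (i : Fin n) (x : ℝ) : ℝ :=
  max 0 (P.peakDensity i - P.slope i * |x - P.peak i|)

/-- The value `V_i(S)`. -/
noncomputable def value (i : Fin n) (S : Set ℝ) : ℝ :=
  ∫ x in S, P.density i x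

/-- The interval `U_i` of points of the cake at which agent `i` has positive density. -/
def support (i : Fin n) : Set ℝ :=
  {x ∈ Icc (0 : ℝ) 1 | 0 < P.density i x}

/-- The left endpoint `l_i` of `U_i`. -/
noncomputable def left (i : Fin n) : ℝ := sInf (P.support i)

/-- The right endpoint `r_i` of `U_i`. -/
noncomputable def right (i : Fin n) : ℝ := sSup (P.support i)

/-- Every agent is at least as well off under `Y` as under `X`. -/
def WeaklyDominates (Y X : Fin n → Set ℝ) : Prop :=
  ∀ i, P.value i (X i) ≤ P.value i (Y i)

/-- `Y` Pareto dominates `X`. -/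
def ParetoDominates (Y X : Fin n → Set ℝ) : Prop :=
  (∀ i, P.value i (X i) ≤ P.value i (Y i)) ∧ ∃ i, P.value i (X i) < P.value i (Y i)

/-- `X` is a Pareto optimal allocation. -/
def IsParetoOptimal (X : Fin n → Set ℝ) : Prop :=
  IsAllocation X ∧ ¬ ∃ Y, IsAllocation Y ∧ P.ParetoDominates Y X

/-- `X` is an envy-free allocation. -/
def IsEnvyFree (X : Fin n → Set ℝ) : Prop :=
  IsAllocation X ∧ ∀ i j, P.value i (X j) ≤ P.value i (X i)

/-- `X` is an allocation that maximizes the sum of utilities among all allocations. -/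
def MaximizesTotalUtility (X : Fin n → Set ℝ) : Prop :=
  IsAllocation X ∧
    ∀ Y, IsAllocation Y → ∑ i, P.value i (Y i) ≤ ∑ i, P.value i (X i)

/-- `P.byPeak m` is the agent with the `m`-th smallest peak (counting from `0`). -/
noncomputable def byPeak : Equiv.Perm (Fin n) := Tuple.sort P.peak

/-- The connected peak-preserving allocation with cut points `0 = c 0 ≤ c 1 ≤ ⋯ ≤ c n = 1`: the
agent with the smallest peak gets `[0, c 1]`, the agent with the second smallest peak gets
`(c 1, c 2]`, and so on. -/
noncomputable def peakPreserving (c : Fin (n + 1) → ℝ) (i : Fin n) : Set ℝ :=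
  let m := P.byPeak.symm i
  if m.val = 0 then Icc (c m.castSucc) (c m.succ) else Ioc (c m.castSucc) (c m.succ)

/-- The cut points of the utilitarian mechanism: the cut between two agents with adjacent peaks is
the intersection of their densities, located between their peaks. -/
def IsUtilitarianCuts (c : Fin (n + 1) → ℝ) : Prop :=
  c 0 = 0 ∧ c (Fin.last n) = 1 ∧
    ∀ (m : Fin n) (h : m.val + 1 < n),
      c m.succ ∈ Icc (P.peak (P.byPeak m)) (P.peak (P.byPeak ⟨m.val + 1, h⟩)) ∧
      P.density (P.byPeak m) (c m.succ) = P.density (P.byPeak ⟨m.val + 1, h⟩) (c m.succ)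

/-- The cut points of leftmost leaves. The `m`-th agent in the order of peaks (counting from `0`)
finds the point `y` at which the interval from the previous cut to `y` is worth the fraction
`1 / (n - m)` of what remains of the cake, and the next cut is the maximum of `y` and the left
endpoint of the support of the next agent. -/
def IsLeftmostLeavesCuts (c : Fin (n + 1) → ℝ) : Prop :=
  c 0 = 0 ∧ c (Fin.last n) = 1 ∧
    ∀ (m : Fin n) (h : m.val + 1 < n),
      ∃ y ∈ Icc (c m.castSucc) 1,
        P.value (P.byPeak m) (Icc (c m.castSucc) y) =
          P.value (P.byPeak m) (Icc (c m.castSucc) 1) / ((n : ℝ) - (m.val : ℝ)) ∧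
        c m.succ = max y (P.left (P.byPeak ⟨m.val + 1, h⟩))

/-- The points `0`, `1` and `l_i`, `p_i`, `r_i` for all agents `i`. -/
def breakpoints : Set ℝ :=
  {0, 1} ∪ range P.left ∪ range P.peak ∪ range P.right

/-- `a < b` are consecutive breakpoints, so that `[a, b]` is an elementary piece. -/
def IsElementary (a b : ℝ) : Prop :=
  a ∈ P.breakpoints ∧ b ∈ P.breakpoints ∧ a < b ∧ ∀ t ∈ P.breakpoints, t ≤ a ∨ b ≤ t

/-- The `m`-th (counting from `0`) of the `2 N` parts of equal length of the interval from `a` to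
`b`. Parts are half-open on the left, except for the one that starts at the left end `0` of the
cake. -/
noncomputable def part (a b : ℝ) (N m : ℕ) : Set ℝ :=
  let x := a + (m : ℝ) * ((b - a) / (2 * (N : ℝ)))
  let y := a + ((m : ℝ) + 1) * ((b - a) / (2 * (N : ℝ)))
  if x = 0 then Icc x y else Ioc x y

/-- Each elementary piece `[a, b]` is cut into `2 N` parts of equal length, where `N` is the number
of agents in `I a b`; the first agent in `I a b` gets the first and the last part, the second agent
in `I a b` gets the second and the last but one, and so on. The result is the union of all parts
that agent `i` gets. -/
noncomputable def symmetricShares (I : ℝ → ℝ → Finset (Fin n)) (i : Fin n) : Set ℝ :=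
  {x | ∃ a b, P.IsElementary a b ∧ i ∈ I a b ∧
    x ∈ part a b (I a b).card ((I a b).filter (· < i)).card ∪
      part a b (I a b).card (2 * (I a b).card - 1 - ((I a b).filter (· < i)).card)}

/-- The Wang–Wu allocation: each elementary piece is shared among all agents. -/
noncomputable def wangWu : Fin n → Set ℝ :=
  P.symmetricShares fun _ _ => Finset.univ

open Classical in
/-- The agents who have a positive value for the elementary piece `[a, b]`. -/
noncomputable def interested (a b : ℝ) : Finset (Fin n) :=
  Finset.univ.filter fun i => (P.support i ∩ Icc a b).Nonempty

/-- The modified Wang–Wu allocation: each elementary piece is shared among the agents who have a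
positive value for it. -/
noncomputable def modifiedWangWu : Fin n → Set ℝ :=
  P.symmetricShares P.interested

end CakeProblem

/-!
Write `t_i` for the tent of agent `i`, so that the density `v_i` is the positive part of `t_i`.

With a common slope and a common value of the whole cake, no tent lies above another one
(`peakDensity_sub_lt`). Hence two tents with different peaks cross exactly once, between the peaks,
the endpoints of the supports are ordered like the peaks, and for `p_i < p_j` the ratio `v_i / v_j`
is nonincreasing (`density_mul_le`). As the supports cover the cake, the supports of agents with
adjacent peaks leave no gap (`left_byPeak_succ_le`).

* Utilitarian mechanism: the only possible cuts are the crossings of the tents with adjacent peaks,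
  and with these cuts every point goes to an agent with the highest density there.
* Leftmost leaves: each cut is to the left of the right end of what the next agent values, so the
  next cut exists and is unique. Pareto optimality holds for all connected allocations in the order
  of the peaks in which each cut lies between the left end of the next support and the right end of
  the previous one (`isParetoOptimal_peakPreserving`); it rests on an exchange argument with the
  monotone likelihood ratio (`value_Ioc_one_le_of_le`). The same single crossing gives strict
  stochastic dominance (`value_Ioc_one_lt`), by which everybody gets at least `1 / n`, and the
  second agent gets more.
* Wang–Wu: the density is affine on elementary pieces, so two symmetric parts are worth the `N`-th
  part of the piece's value to everybody (`value_part_add_value_part`). Hence the Wang–Wu allocation is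
  worth `1 / n` to everybody. In the modified mechanism an agent takes part in all pieces of
  positive value to them, and shares them with fewer agents whenever some agent is not interested.
-/

namespace CakeProblem

variable {n : ℕ} (P : CakeProblem n)

/-! ### Densities and values -/

/-- The tent function of which the density is the positive part. -/
noncomputable def tent (i : Fin n) (x : ℝ) : ℝ :=
  P.peakDensity i - P.slope i * |x - P.peak i|

/-- The left zero of the tent of agent `i`, which may lie outside the cake. -/
noncomputable def leftFoot (i : Fin n) : ℝ := P.peak i - P.peakDensity i / P.slope i

/-- The right zero of the tent of agent `i`, which may lie outside the cake. -/
noncomputable def rightFoot (i : Fin n) : ℝ := P.peak i + P.peakDensity i / P.slope i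

lemma density_eq (i : Fin n) (x : ℝ) : P.density i x = max 0 (P.tent i x) := rfl

lemma continuous_density (i : Fin n) : Continuous (P.density i) := by
  unfold density; fun_prop

lemma density_nonneg (i : Fin n) (x : ℝ) : 0 ≤ P.density i x := le_max_left _ _

lemma integrableOn_density (i : Fin n) {S : Set ℝ} (hS : S ⊆ Icc 0 1) :
    IntegrableOn (P.density i) S :=
  ((P.continuous_density i).integrableOn_Icc).mono_set hS

lemma intervalIntegrable_density (i : Fin n) (a b : ℝ) :
    IntervalIntegrable (P.density i) volume a b :=
  (P.continuous_density i).intervalIntegrable a b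

lemma value_nonneg (i : Fin n) (S : Set ℝ) : 0 ≤ P.value i S :=
  integral_nonneg (P.density_nonneg i)

lemma value_mono (i : Fin n) {S T : Set ℝ} (hT : T ⊆ Icc 0 1) (hST : S ⊆ T) :
    P.value i S ≤ P.value i T :=
  setIntegral_mono_set (P.integrableOn_density i hT)
    (Filter.Eventually.of_forall (P.density_nonneg i)) hST.eventuallyLE

lemma value_union (i : Fin n) {S T : Set ℝ} (hS : S ⊆ Icc 0 1) (hT : T ⊆ Icc 0 1)
    (hTm : MeasurableSet T) (hd : Disjoint S T) :
    P.value i (S ∪ T) = P.value i S + P.value i T :=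
  setIntegral_union hd hTm (P.integrableOn_density i hS) (P.integrableOn_density i hT)

lemma value_sdiff_add_value_inter (i : Fin n) {S T : Set ℝ} (hS : S ⊆ Icc 0 1)
    (hTm : MeasurableSet T) :
    P.value i (S \ T) + P.value i (S ∩ T) = P.value i S := by
  rw [add_comm]
  exact integral_inter_add_sdiff hTm (P.integrableOn_density i hS)

lemma value_Icc (i : Fin n) (a b : ℝ) : P.value i (Icc a b) = P.value i (Ioc a b) :=
  integral_Icc_eq_integral_Ioc

lemma value_Ioc (i : Fin n) {a b : ℝ} (h : a ≤ b) :
    P.value i (Ioc a b) = ∫ x in a..b, P.density i x :=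
  (intervalIntegral.integral_of_le h).symm

lemma value_Ioc_add (i : Fin n) {a b c : ℝ} (hab : a ≤ b) (hbc : b ≤ c) :
    P.value i (Ioc a b) + P.value i (Ioc b c) = P.value i (Ioc a c) := by
  rw [P.value_Ioc i hab, P.value_Ioc i hbc, P.value_Ioc i (hab.trans hbc)]
  exact intervalIntegral.integral_add_adjacent_intervals
    (P.intervalIntegrable_density i _ _) (P.intervalIntegrable_density i _ _)

lemma value_cake (i : Fin n) : P.value i (Icc 0 1) = 1 := P.normalized i

lemma value_Ioc_zero_one (i : Fin n) : P.value i (Ioc 0 1) = 1 := by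
  rw [← value_Icc, value_cake]

lemma value_Ioc_pos (i : Fin n) {a b x : ℝ} (hx : x ∈ Icc a b) (hab : a < b)
    (h : 0 < P.density i x) : 0 < P.value i (Ioc a b) := by
  rw [P.value_Ioc i hab.le]
  exact intervalIntegral.integral_pos hab (P.continuous_density i).continuousOn
    (fun y _ => P.density_nonneg i y) ⟨x, hx, h⟩

lemma exists_density_pos_of_value_pos (i : Fin n) {a b : ℝ} (h : 0 < P.value i (Ioc a b)) :
    ∃ x ∈ Ioo a b, 0 < P.density i x := by
  by_contra! hcon
  refine h.ne' ?_
  rw [value, integral_Ioc_eq_integral_Ioo]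
  exact setIntegral_eq_zero_of_forall_eq_zero
    fun x hx => le_antisymm (hcon x hx) (P.density_nonneg i x)

lemma peakDensity_pos (i : Fin n) : 0 < P.peakDensity i := by
  by_contra! hcon
  have h0 : P.value i (Icc 0 1) = 0 := by
    refine setIntegral_eq_zero_of_forall_eq_zero fun x _ => max_eq_left ?_
    have := mul_nonneg (P.slope_pos i).le (abs_nonneg (x - P.peak i))
    linarith
  rw [value_cake] at h0
  exact one_ne_zero h0

lemma tent_peak (i : Fin n) : P.tent i (P.peak i) = P.peakDensity i := by simp [tent]

lemma density_pos_iff_tent (i : Fin n) (x : ℝ) : 0 < P.density i x ↔ 0 < P.tent i x := by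
  simp [density_eq]

lemma density_peak_pos (i : Fin n) : 0 < P.density i (P.peak i) := by
  rw [density_pos_iff_tent, tent_peak]
  exact P.peakDensity_pos i

lemma density_pos_iff (i : Fin n) (x : ℝ) :
    0 < P.density i x ↔ P.leftFoot i < x ∧ x < P.rightFoot i := by
  have hk := P.slope_pos i
  rw [density_pos_iff_tent, tent, leftFoot, rightFoot, sub_pos, ← lt_div_iff₀' hk, abs_lt]
  constructor <;> rintro ⟨h1, h2⟩ <;> constructor <;> linarith

lemma leftFoot_lt_peak (i : Fin n) : P.leftFoot i < P.peak i :=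
  ((P.density_pos_iff i _).1 (P.density_peak_pos i)).1

lemma peak_lt_rightFoot (i : Fin n) : P.peak i < P.rightFoot i :=
  ((P.density_pos_iff i _).1 (P.density_peak_pos i)).2

lemma left_eq (i : Fin n) : P.left i = max 0 (P.leftFoot i) := by
  have hp := P.peak_mem i
  have hL := P.leftFoot_lt_peak i
  have hR := P.peak_lt_rightFoot i
  refine csInf_eq_of_forall_ge_of_forall_gt_exists_lt
    ⟨P.peak i, hp, P.density_peak_pos i⟩ ?_ ?_
  · rintro x ⟨hx, hd⟩
    exact max_le hx.1 ((P.density_pos_iff i x).1 hd).1.le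
  · intro w hw
    rcases lt_or_ge (P.peak i) w with h | h
    · exact ⟨P.peak i, ⟨hp, P.density_peak_pos i⟩, h⟩
    · rw [max_lt_iff] at hw
      obtain ⟨x, hx, hxw⟩ := exists_between (max_lt hw.1 hw.2)
      rw [max_lt_iff] at hx
      exact ⟨x, ⟨⟨hx.1.le, by linarith [hp.2]⟩, (P.density_pos_iff i x).2 ⟨hx.2, by linarith⟩⟩, hxw⟩

lemma right_eq (i : Fin n) : P.right i = min 1 (P.rightFoot i) := by
  have hp := P.peak_mem i
  have hL := P.leftFoot_lt_peak i
  have hR := P.peak_lt_rightFoot i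
  refine csSup_eq_of_forall_le_of_forall_lt_exists_gt
    ⟨P.peak i, hp, P.density_peak_pos i⟩ ?_ ?_
  · rintro x ⟨hx, hd⟩
    exact le_min hx.2 ((P.density_pos_iff i x).1 hd).2.le
  · intro w hw
    rcases lt_or_ge w (P.peak i) with h | h
    · exact ⟨P.peak i, ⟨hp, P.density_peak_pos i⟩, h⟩
    · rw [lt_min_iff] at hw
      obtain ⟨x, hxw, hx⟩ := exists_between (lt_min hw.1 hw.2)
      rw [lt_min_iff] at hx
      exact ⟨x, ⟨⟨by linarith [hp.1], hx.1.le⟩, (P.density_pos_iff i x).2 ⟨by linarith, hx.2⟩⟩, hxw⟩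

lemma left_le_peak (i : Fin n) : P.left i ≤ P.peak i := by
  rw [left_eq]; exact max_le (P.peak_mem i).1 (P.leftFoot_lt_peak i).le

lemma peak_le_right (i : Fin n) : P.peak i ≤ P.right i := by
  rw [right_eq]; exact le_min (P.peak_mem i).2 (P.peak_lt_rightFoot i).le

lemma left_nonneg (i : Fin n) : 0 ≤ P.left i := by rw [left_eq]; exact le_max_left _ _

lemma right_le_one (i : Fin n) : P.right i ≤ 1 := by rw [right_eq]; exact min_le_left _ _

lemma left_lt_right (i : Fin n) : P.left i < P.right i := by
  have hp := P.peak_mem i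
  have hL := P.leftFoot_lt_peak i
  have hR := P.peak_lt_rightFoot i
  rw [left_eq, right_eq]
  simp only [max_lt_iff, lt_min_iff]
  refine ⟨⟨one_pos, ?_⟩, ?_, ?_⟩ <;> linarith [hp.1, hp.2]

lemma density_pos_of_mem_Ioo (i : Fin n) {x : ℝ} (hx : x ∈ Ioo (P.left i) (P.right i)) :
    0 < P.density i x := by
  rw [left_eq, right_eq] at hx
  exact (P.density_pos_iff i x).2 ⟨(le_max_right _ _).trans_lt hx.1, hx.2.trans_le (min_le_right _ _)⟩

lemma support_subset (i : Fin n) : P.support i ⊆ Icc (P.left i) (P.right i) := by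
  rintro x ⟨hx, hd⟩
  rw [density_pos_iff] at hd
  rw [left_eq, right_eq]
  exact ⟨max_le hx.1 hd.1.le, le_min hx.2 hd.2.le⟩

lemma exists_mem_Icc_left_right {x : ℝ} (hx : x ∈ Icc (0 : ℝ) 1) :
    ∃ i, x ∈ Icc (P.left i) (P.right i) := by
  obtain ⟨i, hi⟩ := mem_iUnion.1 (P.covered hx)
  exact ⟨i, closure_minimal (P.support_subset i) isClosed_Icc hi⟩

lemma value_Ioc_zero_left (i : Fin n) : P.value i (Ioc 0 (P.left i)) = 0 := by
  by_contra! h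
  obtain ⟨x, hx, hd⟩ := P.exists_density_pos_of_value_pos i
    ((P.value_nonneg i _).lt_of_ne h.symm)
  refine absurd (P.support_subset i ⟨⟨hx.1.le, ?_⟩, hd⟩).1 (not_le.2 hx.2)
  exact hx.2.le.trans ((P.left_lt_right i).le.trans (P.right_le_one i))

lemma value_Ioc_left_one (i : Fin n) : P.value i (Ioc (P.left i) 1) = 1 := by
  have := P.value_Ioc_add i (P.left_nonneg i) ((P.left_lt_right i).le.trans (P.right_le_one i))
  rwa [value_Ioc_zero_left, value_Ioc_zero_one, zero_add] at this

/-- If, off a point `c`, agent `i` values all that agent `j` values in `S`, then a set which is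
worthless for `i` is worthless for `j`. -/
lemma value_eq_zero_of_value_eq_zero {i j : Fin n} {S : Set ℝ} (hS : S ⊆ Icc 0 1)
    (hSm : MeasurableSet S) (c : ℝ)
    (h : ∀ x ∈ S, x ≠ c → 0 < P.density j x → 0 < P.density i x) (h0 : P.value i S = 0) :
    P.value j S = 0 := by
  have h1 : P.density i =ᵐ[volume.restrict S] 0 :=
    (setIntegral_eq_zero_iff_of_nonneg_ae
      (Filter.Eventually.of_forall (P.density_nonneg i)) (P.integrableOn_density i hS)).1 h0
  refine (setIntegral_eq_zero_iff_of_nonneg_ae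
    (Filter.Eventually.of_forall (P.density_nonneg j)) (P.integrableOn_density j hS)).2 ?_
  have h2 : ∀ᵐ x ∂(volume.restrict S), x ≠ c :=
    ae_restrict_of_ae (by simp [ae_iff])
  filter_upwards [h1, h2, ae_restrict_mem hSm] with x hx hxc hxS
  by_contra hne
  exact (h x hxS hxc ((P.density_nonneg j x).lt_of_ne (Ne.symm hne))).ne' hx

/-! ### Two agents with a common slope -/

/-- Otherwise the density of `j` would be at least that of `i` everywhere and larger at the peak of
`j`, against the normalization. -/
lemma peakDensity_sub_lt {i j : Fin n} (hs : P.slope i = P.slope j)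
    (hne : P.peak i ≠ P.peak j) :
    P.peakDensity j - P.peakDensity i < P.slope i * |P.peak i - P.peak j| := by
  by_contra! hcon
  have hk := P.slope_pos i
  have hpos : 0 < |P.peak i - P.peak j| := abs_pos.2 (sub_ne_zero.2 hne)
  have hlt : (∫ x in (0 : ℝ)..1, P.density i x) < ∫ x in (0 : ℝ)..1, P.density j x := by
    refine intervalIntegral.integral_lt_integral_of_continuousOn_of_le_of_exists_lt one_pos
      (P.continuous_density i).continuousOn (P.continuous_density j).continuousOn
      (fun x _ => ?_) ⟨P.peak j, P.peak_mem j, ?_⟩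
    · refine max_le_max le_rfl ?_
      have h1 : |x - P.peak j| ≤ |x - P.peak i| + |P.peak i - P.peak j| := abs_sub_le _ _ _
      have h2 := mul_le_mul_of_nonneg_left h1 hk.le
      rw [← hs]
      linarith
    · have h3 := P.density_peak_pos j
      rw [density_pos_iff_tent] at h3
      rw [density_eq, density_eq, max_eq_right h3.le, max_lt_iff, tent_peak]
      refine ⟨P.peakDensity_pos j, ?_⟩
      rw [tent, abs_sub_comm]
      have := mul_pos hk hpos
      linarith
  rw [← P.value_Ioc i zero_le_one, ← P.value_Ioc j zero_le_one, value_Ioc_zero_one,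
    value_Ioc_zero_one] at hlt
  exact lt_irrefl _ hlt

section TwoAgents

variable {i j : Fin n} (hs : P.slope i = P.slope j) (hp : P.peak i < P.peak j)
include hs hp

lemma peakDensity_sub_lt_right :
    P.peakDensity j - P.peakDensity i < P.slope i * (P.peak j - P.peak i) := by
  have := P.peakDensity_sub_lt hs hp.ne
  rwa [abs_sub_comm, abs_of_pos (sub_pos.2 hp)] at this

lemma peakDensity_sub_lt_left :
    P.peakDensity i - P.peakDensity j < P.slope i * (P.peak j - P.peak i) := by
  have := P.peakDensity_sub_lt hs.symm hp.ne'
  rwa [abs_of_pos (sub_pos.2 hp), ← hs] at this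

lemma leftFoot_lt_leftFoot : P.leftFoot i < P.leftFoot j := by
  have h := P.peakDensity_sub_lt_right hs hp
  have hk := P.slope_pos i
  rw [leftFoot, leftFoot, ← hs]
  have : (P.peakDensity j - P.peakDensity i) / P.slope i < P.peak j - P.peak i := by
    rwa [div_lt_iff₀' hk]
  rw [sub_div] at this
  linarith

lemma rightFoot_lt_rightFoot : P.rightFoot i < P.rightFoot j := by
  have h := P.peakDensity_sub_lt_left hs hp
  have hk := P.slope_pos i
  rw [rightFoot, rightFoot, ← hs]
  have : (P.peakDensity i - P.peakDensity j) / P.slope i < P.peak j - P.peak i := by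
    rwa [div_lt_iff₀' hk]
  rw [sub_div] at this
  linarith

lemma left_le_left : P.left i ≤ P.left j := by
  rw [left_eq, left_eq]
  exact max_le_max le_rfl (P.leftFoot_lt_leftFoot hs hp).le

lemma right_le_right : P.right i ≤ P.right j := by
  rw [right_eq, right_eq]
  exact min_le_min le_rfl (P.rightFoot_lt_rightFoot hs hp).le

lemma tent_sub_tent_antitone {x y : ℝ} (hxy : x ≤ y) :
    P.tent i y - P.tent j y ≤ P.tent i x - P.tent j x := by
  have hk := P.slope_pos i
  simp only [tent, ← hs]
  have : |x - P.peak i| + |y - P.peak j| ≤ |y - P.peak i| + |x - P.peak j| := by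
    rcases abs_cases (x - P.peak i) with h1 | h1 <;> rcases abs_cases (y - P.peak j) with h2 | h2 <;>
    rcases abs_cases (y - P.peak i) with h3 | h3 <;> rcases abs_cases (x - P.peak j) with h4 | h4 <;>
    linarith
  have := mul_le_mul_of_nonneg_left this hk.le
  linarith

lemma tent_lt_tent_of_le_peak {x : ℝ} (hx : x ≤ P.peak i) : P.tent j x < P.tent i x := by
  have h := P.peakDensity_sub_lt_right hs hp
  simp only [tent, ← hs]
  rw [abs_of_nonpos (sub_nonpos.2 hx), abs_of_nonpos (sub_nonpos.2 (hx.trans hp.le))]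
  linarith

lemma tent_lt_tent_of_peak_le {x : ℝ} (hx : P.peak j ≤ x) : P.tent i x < P.tent j x := by
  have h := P.peakDensity_sub_lt_left hs hp
  simp only [tent, ← hs]
  rw [abs_of_nonneg (sub_nonneg.2 hx), abs_of_nonneg (sub_nonneg.2 (hp.le.trans hx))]
  linarith

lemma tent_lt_tent_of_lt_of_le {x y : ℝ} (hxy : x < y) (hy : P.tent j y ≤ P.tent i y) :
    P.tent j x < P.tent i x := by
  rcases le_or_gt x (P.peak i) with h | h
  · exact P.tent_lt_tent_of_le_peak hs hp h
  have hy' : y < P.peak j := by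
    by_contra! hcon
    exact absurd (P.tent_lt_tent_of_peak_le hs hp hcon) (not_lt.2 hy)
  have := mul_pos (P.slope_pos i) (sub_pos.2 hxy)
  simp only [tent, ← hs] at hy ⊢
  rw [abs_of_pos (sub_pos.2 (h.trans hxy)), abs_of_neg (sub_neg.2 hy')] at hy
  rw [abs_of_pos (sub_pos.2 h), abs_of_neg (sub_neg.2 (hxy.trans hy'))]
  linarith

lemma tent_lt_tent_of_le_of_lt {x y : ℝ} (hx : P.tent i x ≤ P.tent j x) (hxy : x < y) :
    P.tent i y < P.tent j y := by
  by_contra! hcon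
  exact absurd (P.tent_lt_tent_of_lt_of_le hs hp hxy hcon) (not_lt.2 hx)

/-- The monotone likelihood ratio property: `v_i / v_j` is nonincreasing if the peak of `i` is to
the left of the peak of `j`. -/
lemma density_mul_le {x y : ℝ} (hxy : x ≤ y) :
    P.density i y * P.density j x ≤ P.density i x * P.density j y := by
  have hk := P.slope_pos i
  have hnn := mul_nonneg (P.density_nonneg i x) (P.density_nonneg j y)
  rcases (P.density_nonneg i y).eq_or_lt with h | hiy
  · rwa [← h, zero_mul]
  rcases (P.density_nonneg j x).eq_or_lt with h | hjx
  · rwa [← h, mul_zero]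
  have hix : 0 < P.density i x := by
    rw [density_pos_iff] at *
    exact ⟨(P.leftFoot_lt_leftFoot hs hp).trans hjx.1, hxy.trans_lt hiy.2⟩
  have hjy : 0 < P.density j y := by
    rw [density_pos_iff] at *
    exact ⟨hjx.1.trans_le hxy, hiy.2.trans (P.rightFoot_lt_rightFoot hs hp)⟩
  have hD := P.tent_sub_tent_antitone hs hp hxy
  rw [density_pos_iff_tent] at hix hiy hjx hjy
  simp only [density_eq]
  rw [max_eq_right hix.le, max_eq_right hiy.le, max_eq_right hjx.le, max_eq_right hjy.le]
  rcases le_or_gt (P.tent i y) (P.tent j y) with h1 | h1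
  · rcases le_or_gt (P.tent j x) (P.tent i x) with h2 | h2
    · nlinarith
    · -- Both points are to the right of the intersection, where the tent of `i` decreases.
      have hxi : P.peak i < x := by
        by_contra! hcon
        exact absurd (P.tent_lt_tent_of_le_peak hs hp hcon) h2.le.not_gt
      have : P.tent i y ≤ P.tent i x := by
        simp only [tent]
        rw [abs_of_pos (by linarith), abs_of_pos (by linarith)]
        nlinarith
      nlinarith
  · -- Both points are to the left of the intersection, where the tent of `j` increases.
    have hyj : y < P.peak j := by
      by_contra! hcon
      exact absurd (P.tent_lt_tent_of_peak_le hs hp hcon) h1.le.not_gt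
    have : P.tent j x ≤ P.tent j y := by
      simp only [tent]
      rw [abs_of_neg (by linarith), abs_of_neg (by linarith)]
      nlinarith [P.slope_pos j]
    nlinarith

/-- The monotone likelihood ratio property for sets: `B` is to the left of `C`. -/
lemma value_mul_le {B C : Set ℝ} (hB : B ⊆ Icc 0 1) (hC : C ⊆ Icc 0 1)
    (hBm : MeasurableSet B) (hCm : MeasurableSet C) (hBC : ∀ x ∈ B, ∀ y ∈ C, x ≤ y) :
    P.value i C * P.value j B ≤ P.value i B * P.value j C := by
  have h1 : ∀ y ∈ C, P.density i y * P.value j B ≤ P.value i B * P.density j y := by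
    intro y hy
    rw [value, value, ← integral_const_mul, ← integral_mul_const]
    exact setIntegral_mono_on ((P.integrableOn_density j hB).const_mul _)
      ((P.integrableOn_density i hB).mul_const _) hBm
      fun x hx => P.density_mul_le hs hp (hBC x hx y hy)
  rw [show P.value i C = ∫ y in C, P.density i y from rfl,
    show P.value j C = ∫ y in C, P.density j y from rfl, ← integral_const_mul,
    ← integral_mul_const]
  exact setIntegral_mono_on ((P.integrableOn_density i hC).mul_const _)
    ((P.integrableOn_density j hC).const_mul _) hCm h1

/-- If `j` likes `A` at least as much as the part of the cake to the right of `c`, then so does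
`i`, whose peak is to the left of that of `j`; and a strict preference of `j` is shared by `i`. The
bounds on `c` make sure that `j` values all that `i` values to the right of `c`, and that `i` values
all that `j` values to the left of `c`. -/
lemma value_Ioc_one_le_of_le {c : ℝ} (hc : 0 ≤ c) (hjc : P.left j ≤ c) (hci : c ≤ P.right i)
    {A : Set ℝ} (hA : A ⊆ Icc 0 1) (hAm : MeasurableSet A)
    (h : P.value j (Ioc c 1) ≤ P.value j A) :
    P.value i (Ioc c 1) ≤ P.value i A ∧
      (P.value j (Ioc c 1) < P.value j A → P.value i (Ioc c 1) < P.value i A) := by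
  have hI : Ioc c 1 ⊆ Icc (0 : ℝ) 1 := fun x hx => ⟨hc.trans hx.1.le, hx.2⟩
  set B := A \ Ioc c 1 with hBdef
  set C := Ioc c 1 \ A with hCdef
  have hB : B ⊆ Icc 0 1 := sdiff_subset.trans hA
  have hC : C ⊆ Icc 0 1 := sdiff_subset.trans hI
  have hBm : MeasurableSet B := hAm.diff measurableSet_Ioc
  have hCm : MeasurableSet C := measurableSet_Ioc.diff hAm
  have hBc : ∀ x ∈ B, x ≤ c := fun x hx => by
    by_contra! hcx
    exact hx.2 ⟨hcx, (hA hx.1).2⟩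
  have hcC : ∀ y ∈ C, c < y := fun y hy => hy.1.1
  have key := P.value_mul_le hs hp hB hC hBm hCm fun x hx y hy => (hBc x hx).trans (hcC y hy).le
  have hAj := P.value_sdiff_add_value_inter j hA (measurableSet_Ioc (a := c) (b := 1))
  have hAi := P.value_sdiff_add_value_inter i hA (measurableSet_Ioc (a := c) (b := 1))
  have hIj := P.value_sdiff_add_value_inter j hI hAm
  have hIi := P.value_sdiff_add_value_inter i hI hAm
  rw [inter_comm] at hIj hIi
  rw [← hBdef] at hAj hAi
  rw [← hCdef] at hIj hIi
  have zC : P.value j C = 0 → P.value i C = 0 := by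
    refine P.value_eq_zero_of_value_eq_zero hC hCm c fun x hx _ hd => ?_
    rw [density_pos_iff] at hd ⊢
    refine ⟨?_, hd.2.trans (P.rightFoot_lt_rightFoot hs hp)⟩
    rw [left_eq] at hjc
    exact (le_max_right _ _).trans_lt (hjc.trans_lt (hcC x hx))
  have zB : P.value i B = 0 → P.value j B = 0 := by
    refine P.value_eq_zero_of_value_eq_zero hB hBm c fun x hx hxc hd => ?_
    rw [density_pos_iff] at hd ⊢
    refine ⟨(P.leftFoot_lt_leftFoot hs hp).trans hd.1, ?_⟩
    rw [right_eq] at hci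
    exact ((hBc x hx).lt_of_ne hxc).trans_le (hci.trans (min_le_right _ _))
  have nB := P.value_nonneg i B
  have nC := P.value_nonneg i C
  have mB := P.value_nonneg j B
  have mC := P.value_nonneg j C
  have hCB : P.value j C ≤ P.value j B := by linarith
  rcases mC.eq_or_lt with h0 | hpos
  · have hC0 := zC h0.symm
    refine ⟨by linarith, fun hlt => ?_⟩
    have : P.value i B ≠ 0 := fun hB0 => by linarith [zB hB0]
    have := nB.lt_of_ne this.symm
    linarith
  · have hle : P.value i C ≤ P.value i B := by
      have : P.value i C * P.value j C ≤ P.value i B * P.value j C :=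
        (mul_le_mul_of_nonneg_left hCB nC).trans key
      exact le_of_mul_le_mul_right this hpos
    refine ⟨by linarith, fun hlt => ?_⟩
    rcases nC.eq_or_lt with h1 | h1
    · have : P.value i B ≠ 0 := fun hB0 => by linarith [zB hB0]
      have := nB.lt_of_ne this.symm
      linarith
    · have h2 : P.value j C < P.value j B := by linarith
      have : P.value i C * P.value j C < P.value i B * P.value j C :=
        (mul_lt_mul_of_pos_left h2 h1).trans_le key
      have := lt_of_mul_lt_mul_right this hpos.le
      linarith

/-- Strict stochastic dominance: of a part of the cake to the right of a cut, the agent with the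
peak further to the right gets the higher value. -/
lemma value_Ioc_one_lt {y : ℝ} (hy : y ∈ Icc (0 : ℝ) 1) (h0 : 0 < P.value i (Ioc 0 y))
    (h1 : 0 < P.value i (Ioc y 1)) : P.value i (Ioc y 1) < P.value j (Ioc y 1) := by
  obtain ⟨x, hx, hxi⟩ := P.exists_density_pos_of_value_pos i h0
  obtain ⟨x', hx', hxi'⟩ := P.exists_density_pos_of_value_pos i h1
  rcases le_or_gt (P.tent j y) (P.tent i y) with h | h
  · have hlt : (∫ t in (0 : ℝ)..y, P.density j t) < ∫ t in (0 : ℝ)..y, P.density i t := by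
      refine intervalIntegral.integral_lt_integral_of_continuousOn_of_le_of_exists_lt
        (hx.1.trans hx.2) (P.continuous_density j).continuousOn
        (P.continuous_density i).continuousOn (fun t ht => ?_) ⟨x, ⟨hx.1.le, hx.2.le⟩, ?_⟩
      · refine max_le_max le_rfl ?_
        have := P.tent_sub_tent_antitone hs hp ht.2
        change P.tent j t ≤ P.tent i t
        linarith
      · have h2 := P.tent_lt_tent_of_lt_of_le hs hp hx.2 h
        rw [density_eq, max_lt_iff]
        refine ⟨hxi, h2.trans_le (le_max_right _ _)⟩
    rw [← P.value_Ioc j hy.1, ← P.value_Ioc i hy.1] at hlt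
    have e1 := P.value_Ioc_add i hy.1 hy.2
    have e2 := P.value_Ioc_add j hy.1 hy.2
    rw [value_Ioc_zero_one] at e1 e2
    linarith
  · rw [P.value_Ioc i hy.2, P.value_Ioc j hy.2]
    refine intervalIntegral.integral_lt_integral_of_continuousOn_of_le_of_exists_lt
      (hx'.1.trans hx'.2) (P.continuous_density i).continuousOn
      (P.continuous_density j).continuousOn (fun t ht => ?_) ⟨x', ⟨hx'.1.le, hx'.2.le⟩, ?_⟩
    · refine max_le_max le_rfl ?_
      have := P.tent_sub_tent_antitone hs hp ht.1.le
      change P.tent i t ≤ P.tent j t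
      linarith
    · have h2 := P.tent_lt_tent_of_le_of_lt hs hp h.le hx'.1
      rw [density_pos_iff_tent] at hxi'
      rw [density_eq, density_eq, max_eq_right hxi'.le]
      exact h2.trans_le (le_max_right _ _)

end TwoAgents

end CakeProblem

/-! ### Pieces and allocations -/

lemma IsPiece.subset {S : Set ℝ} (h : IsPiece S) : S ⊆ Icc 0 1 := by
  obtain ⟨F, -, -, hF, rfl⟩ := h
  exact sUnion_subset fun I hI => (hF I hI).2

lemma IsPiece.measurableSet {S : Set ℝ} (h : IsPiece S) : MeasurableSet S := by
  obtain ⟨F, hfin, -, hF, rfl⟩ := h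
  exact MeasurableSet.sUnion hfin.countable fun I hI => (hF I hI).1.measurableSet

lemma isPiece_of_ordConnected {S : Set ℝ} (h : S.OrdConnected) (hS : S ⊆ Icc 0 1) : IsPiece S :=
  ⟨{S}, finite_singleton S, pairwiseDisjoint_singleton _ _, by simpa using ⟨h, hS⟩, by simp⟩

namespace CakeProblem

variable {n : ℕ} (P : CakeProblem n)

lemma value_eq_sum_inter (i : Fin n) {Z : Fin n → Set ℝ} (hZ : IsAllocation Z) {S : Set ℝ}
    (hS : S ⊆ Icc 0 1) (hSm : MeasurableSet S) :
    P.value i S = ∑ j, P.value i (S ∩ Z j) := by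
  have h : S = ⋃ j, S ∩ Z j := by
    rw [← inter_iUnion, hZ.2.2, inter_eq_left.2 hS]
  conv_lhs => rw [h]
  exact integral_iUnion_fintype (fun j => hSm.inter (hZ.1 j).measurableSet)
    (fun a b hab => (hZ.2.1 hab).mono inter_subset_right inter_subset_right)
    fun j => P.integrableOn_density i (inter_subset_left.trans hS)

lemma MaximizesTotalUtility.isParetoOptimal {P : CakeProblem n} {X : Fin n → Set ℝ}
    (h : P.MaximizesTotalUtility X) : P.IsParetoOptimal X := by
  refine ⟨h.1, ?_⟩
  rintro ⟨Y, hY, hle, i, hi⟩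
  exact absurd (Finset.sum_lt_sum (fun i _ => hle i) ⟨i, Finset.mem_univ i, hi⟩)
    (not_lt.2 (h.2 Y hY))

/-- If every agent gets only points at which their density is the highest one, then the sum of
utilities is maximal. -/
lemma maximizesTotalUtility_of_density_le {X : Fin n → Set ℝ} (hX : IsAllocation X)
    (h : ∀ i, ∀ x ∈ X i, ∀ j, P.density j x ≤ P.density i x) : P.MaximizesTotalUtility X := by
  refine ⟨hX, fun Y hY => ?_⟩
  calc ∑ i, P.value i (Y i)
      = ∑ i, ∑ j, P.value i (X j ∩ Y i) := Finset.sum_congr rfl fun i _ => by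
        rw [P.value_eq_sum_inter i hX (hY.1 i).subset (hY.1 i).measurableSet]
        exact Finset.sum_congr rfl fun j _ => by rw [inter_comm]
    _ ≤ ∑ i, ∑ j, P.value j (X j ∩ Y i) := by
        refine Finset.sum_le_sum fun i _ => Finset.sum_le_sum fun j _ => ?_
        have hs : X j ∩ Y i ⊆ Icc 0 1 := inter_subset_left.trans (hX.1 j).subset
        exact setIntegral_mono_on (P.integrableOn_density i hs) (P.integrableOn_density j hs)
          ((hX.1 j).measurableSet.inter (hY.1 i).measurableSet) fun x hx => h j x hx.1 i
    _ = ∑ j, P.value j (X j) := by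
        rw [Finset.sum_comm]
        exact Finset.sum_congr rfl fun j _ =>
          (P.value_eq_sum_inter j hY (hX.1 j).subset (hX.1 j).measurableSet).symm

lemma numAgents_pos (P : CakeProblem n) : 0 < n := by
  obtain ⟨i, -⟩ := P.exists_mem_Icc_left_right (left_mem_Icc.2 zero_le_one)
  exact i.pos

/-! ### Connected allocations in the order of the peaks -/

lemma strictMono_peak_byPeak (hpeak : Function.Injective P.peak) :
    StrictMono (P.peak ∘ P.byPeak) :=
  (Tuple.monotone_sort P.peak).strictMono_of_injective (hpeak.comp P.byPeak.injective)

lemma peak_byPeak_lt (hpeak : Function.Injective P.peak) {k m : Fin n} (h : k < m) :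
    P.peak (P.byPeak k) < P.peak (P.byPeak m) := P.strictMono_peak_byPeak hpeak h

/-- The supports of agents with adjacent peaks leave no gap: the supports of all the other agents
start further to the right or end further to the left. -/
lemma left_byPeak_succ_le (hslope : ∀ i j, P.slope i = P.slope j)
    (hpeak : Function.Injective P.peak) (m : Fin n) (h : m.val + 1 < n) :
    P.left (P.byPeak ⟨m.val + 1, h⟩) ≤ P.right (P.byPeak m) := by
  by_contra! hcon
  obtain ⟨x, hx1, hx2⟩ := exists_between hcon
  have hx0 : 0 ≤ x := (P.peak_mem _).1.trans ((P.peak_le_right _).trans hx1.le)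
  have hx3 : x ≤ 1 := hx2.le.trans ((P.left_le_peak _).trans (P.peak_mem _).2)
  obtain ⟨i, hi⟩ := P.exists_mem_Icc_left_right ⟨hx0, hx3⟩
  obtain ⟨k, rfl⟩ := P.byPeak.surjective i
  rcases lt_trichotomy k m with hk | rfl | hk
  · have := P.right_le_right (hslope _ _) (P.peak_byPeak_lt hpeak hk)
    linarith [hi.2]
  · linarith [hi.2]
  · rcases (show (⟨m.val + 1, h⟩ : Fin n) ≤ k from hk).eq_or_lt with rfl | hk
    · linarith [hi.1]
    · have := P.left_le_left (hslope _ _) (P.peak_byPeak_lt hpeak hk)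
      linarith [hi.1]

lemma peakPreserving_byPeak (c : Fin (n + 1) → ℝ) (m : Fin n) :
    P.peakPreserving c (P.byPeak m) =
      if m.val = 0 then Icc (c m.castSucc) (c m.succ) else Ioc (c m.castSucc) (c m.succ) := by
  simp [peakPreserving]

lemma peakPreserving_byPeak_subset (c : Fin (n + 1) → ℝ) (m : Fin n) :
    P.peakPreserving c (P.byPeak m) ⊆ Icc (c m.castSucc) (c m.succ) := by
  rw [peakPreserving_byPeak]
  split_ifs
  exacts [subset_rfl, Ioc_subset_Icc_self]

lemma value_peakPreserving_byPeak (c : Fin (n + 1) → ℝ) (i m : Fin n) :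
    P.value i (P.peakPreserving c (P.byPeak m)) =
      P.value i (Ioc (c m.castSucc) (c m.succ)) := by
  rw [peakPreserving_byPeak]
  split_ifs
  exacts [P.value_Icc i _ _, rfl]

lemma isAllocation_peakPreserving {c : Fin (n + 1) → ℝ} (hc : Monotone c) (h0 : c 0 = 0)
    (h1 : c (Fin.last n) = 1) : IsAllocation (P.peakPreserving c) := by
  have hsub : ∀ i, P.peakPreserving c i ⊆ Icc 0 1 := by
    intro i
    obtain ⟨m, rfl⟩ := P.byPeak.surjective i
    refine (P.peakPreserving_byPeak_subset c m).trans (Icc_subset_Icc ?_ ?_)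
    · rw [← h0]; exact hc (Fin.zero_le _)
    · rw [← h1]; exact hc (Fin.le_last _)
  refine ⟨fun i => isPiece_of_ordConnected ?_ (hsub i), ?_, ?_⟩
  · simp only [peakPreserving]
    split_ifs
    exacts [ordConnected_Icc, ordConnected_Ioc]
  · have key : ∀ k m : Fin n, k < m →
        Disjoint (P.peakPreserving c (P.byPeak k)) (P.peakPreserving c (P.byPeak m)) := by
      intro k m hkm
      rw [P.peakPreserving_byPeak c m, if_neg (by have := Fin.lt_def.1 hkm; omega)]
      rw [Set.disjoint_left]
      intro x hxk hxm
      have h2 : x ≤ c k.succ := (P.peakPreserving_byPeak_subset c k hxk).2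
      have h3 : c k.succ ≤ c m.castSucc := hc (Fin.lt_def.1 hkm)
      exact absurd hxm.1 (not_lt.2 (h2.trans h3))
    intro i j hij
    obtain ⟨k, rfl⟩ := P.byPeak.surjective i
    obtain ⟨m, rfl⟩ := P.byPeak.surjective j
    rcases lt_trichotomy k m with h | rfl | h
    · exact key k m h
    · exact absurd rfl hij
    · exact (key m k h).symm
  · refine Subset.antisymm (iUnion_subset hsub) fun x hx => ?_
    have key : ∀ m : Fin (n + 1), x ≤ c m → x ∈ ⋃ i, P.peakPreserving c i := by
      intro m
      induction m using Fin.induction with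
      | zero =>
        intro hm
        refine mem_iUnion.2 ⟨P.byPeak ⟨0, P.numAgents_pos⟩, ?_⟩
        rw [peakPreserving_byPeak, if_pos rfl]
        exact ⟨h0.le.trans hx.1, hm.trans (hc (Fin.zero_le _))⟩
      | succ k ih =>
        intro hm
        rcases le_or_gt x (c k.castSucc) with h | h
        · exact ih h
        · refine mem_iUnion.2 ⟨P.byPeak k, ?_⟩
          rw [peakPreserving_byPeak]
          split_ifs
          exacts [⟨h.le, hm⟩, ⟨h, hm⟩]
    exact key (Fin.last n) (h1 ▸ hx.2)

/-- A connected peak-preserving allocation is Pareto optimal if each cut lies between the left end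
of what the next agent values and the right end of what the previous agent values. Going through
the agents from right to left, in an allocation that makes nobody worse off, the agents from the
`m`-th on together get a set which the `m`-th of them likes at least as much as what they get in the
given allocation. -/
lemma isParetoOptimal_peakPreserving (hslope : ∀ i j, P.slope i = P.slope j)
    (hpeak : Function.Injective P.peak) {c : Fin (n + 1) → ℝ} (hc : Monotone c) (h0 : c 0 = 0)
    (h1 : c (Fin.last n) = 1)
    (hcut : ∀ (m : Fin n) (h : m.val + 1 < n),
      P.left (P.byPeak ⟨m.val + 1, h⟩) ≤ c m.succ ∧ c m.succ ≤ P.right (P.byPeak m)) :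
    P.IsParetoOptimal (P.peakPreserving c) := by
  refine ⟨P.isAllocation_peakPreserving hc h0 h1, ?_⟩
  rintro ⟨Y, hY, hle, i₀, hlt⟩
  set A : ℕ → Set ℝ := fun t => ⋃ k ∈ {k : Fin n | t ≤ k.val}, Y (P.byPeak k) with hA
  have hAsub : ∀ t, A t ⊆ Icc 0 1 := fun t => iUnion₂_subset fun k _ => (hY.1 _).subset
  have hAm : ∀ t, MeasurableSet (A t) := fun t =>
    MeasurableSet.biUnion (to_countable _) fun k _ => (hY.1 _).measurableSet
  have hAsucc : ∀ m : Fin n, A m.val = A (m.val + 1) ∪ Y (P.byPeak m) := by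
    intro m
    ext x
    simp only [hA, mem_iUnion, mem_ofPred_eq, mem_union, exists_prop]
    constructor
    · rintro ⟨k, hk, hx⟩
      rcases hk.eq_or_lt with h | h
      · exact Or.inr (by rwa [Fin.ext h])
      · exact Or.inl ⟨k, h, hx⟩
    · rintro (⟨k, hk, hx⟩ | hx)
      · exact ⟨k, by omega, hx⟩
      · exact ⟨m, le_rfl, hx⟩
  have hAdisj : ∀ m : Fin n, Disjoint (A (m.val + 1)) (Y (P.byPeak m)) := by
    intro m
    refine disjoint_iUnion₂_left.2 fun k hk => hY.2.1 fun h => ?_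
    have hk' : m.val + 1 ≤ k.val := hk
    rw [P.byPeak.injective h] at hk'
    omega
  have hAval : ∀ i m, P.value i (A (m : Fin n).val) =
      P.value i (A (m.val + 1)) + P.value i (Y (P.byPeak m)) := fun i m => by
    rw [hAsucc m]
    exact P.value_union i (hAsub _) (hY.1 _).subset (hY.1 _).measurableSet (hAdisj m)
  have hc1 : ∀ m, c m ≤ 1 := fun m => h1 ▸ hc (Fin.le_last m)
  have hc0 : ∀ m, 0 ≤ c m := fun m => h0 ▸ hc (Fin.zero_le m)
  have key : ∀ d : ℕ, ∀ m : Fin n, m.val + 1 + d = n →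
      P.value (P.byPeak m) (Ioc (c m.castSucc) 1) ≤ P.value (P.byPeak m) (A m.val) ∧
      ((∃ k, m ≤ k ∧ P.value (P.byPeak k) (P.peakPreserving c (P.byPeak k)) <
          P.value (P.byPeak k) (Y (P.byPeak k))) →
        P.value (P.byPeak m) (Ioc (c m.castSucc) 1) < P.value (P.byPeak m) (A m.val)) := by
    intro d
    induction d with
    | zero =>
      intro m hm
      have hlast : m.succ = Fin.last n := Fin.ext (by simpa using hm)
      have hv := P.value_peakPreserving_byPeak c (P.byPeak m) m
      rw [hlast, h1] at hv
      have hn := P.value_nonneg (P.byPeak m) (A (m.val + 1))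
      rw [hAval, ← hv]
      refine ⟨by linarith [hle (P.byPeak m)], ?_⟩
      rintro ⟨k, hk, hlt⟩
      have : k = m := Fin.ext (by have := Fin.le_def.1 hk; omega)
      subst this
      linarith
    | succ d ih =>
      intro m hm
      have hm' : m.val + 1 < n := by omega
      obtain ⟨ih1, ih2⟩ := ih ⟨m.val + 1, hm'⟩ (by change m.val + 1 + 1 + d = n; omega)
      have hlt' : m < ⟨m.val + 1, hm'⟩ := Fin.lt_def.2 (Nat.lt_succ_self _)
      have e : (⟨m.val + 1, hm'⟩ : Fin n).castSucc = m.succ := rfl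
      rw [e] at ih1 ih2
      have hx := P.value_Ioc_one_le_of_le (hslope _ _) (P.peak_byPeak_lt hpeak hlt')
        (hc0 m.succ) (hcut m hm').1 (hcut m hm').2 (hAsub (m.val + 1)) (hAm _) ih1
      have hv := P.value_peakPreserving_byPeak c (P.byPeak m) m
      have hadd := P.value_Ioc_add (P.byPeak m) (hc (Fin.castSucc_lt_succ (i := m)).le)
        (hc1 m.succ)
      rw [hAval, ← hadd, ← hv]
      have hlem := hle (P.byPeak m)
      refine ⟨by linarith [hx.1], ?_⟩
      rintro ⟨k, hk, hlt⟩
      rcases hk.eq_or_lt with rfl | hk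
      · linarith [hx.1]
      · have := hx.2 (ih2 ⟨k, hk, hlt⟩)
        linarith
  obtain ⟨k₀, rfl⟩ := P.byPeak.surjective i₀
  have hfin := (key (n - 1) ⟨0, P.numAgents_pos⟩ (by
    have := P.numAgents_pos; change 0 + 1 + (n - 1) = n; omega)).2 ⟨k₀, Nat.zero_le _, hlt⟩
  have e : (⟨0, P.numAgents_pos⟩ : Fin n).castSucc = 0 := rfl
  rw [e, h0, value_Ioc_zero_one] at hfin
  have := P.value_mono (P.byPeak ⟨0, P.numAgents_pos⟩) (T := Icc 0 1) subset_rfl (hAsub 0)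
  rw [value_cake] at this
  exact absurd hfin (not_lt.2 this)

/-! ### The utilitarian mechanism -/

/-- The intersection of the tents of `i` and `j` between their peaks. -/
noncomputable def crossing (i j : Fin n) : ℝ :=
  (P.peak i + P.peak j) / 2 + (P.peakDensity i - P.peakDensity j) / (2 * P.slope i)

section TwoAgents

variable {i j : Fin n} (hs : P.slope i = P.slope j) (hp : P.peak i < P.peak j)
include hs hp

lemma crossing_mem : P.crossing i j ∈ Ioo (P.peak i) (P.peak j) := by
  have hk := P.slope_pos i
  have h1 := P.peakDensity_sub_lt_right hs hp
  have h2 := P.peakDensity_sub_lt_left hs hp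
  have e : (P.peakDensity i - P.peakDensity j) / (2 * P.slope i) =
      (P.peakDensity i - P.peakDensity j) / P.slope i / 2 := by
    rw [div_div, mul_comm]
  have h3 : (P.peakDensity i - P.peakDensity j) / P.slope i < P.peak j - P.peak i := by
    rwa [div_lt_iff₀' hk]
  have h4 : -(P.peak j - P.peak i) < (P.peakDensity i - P.peakDensity j) / P.slope i := by
    rw [lt_div_iff₀' hk]; linarith
  rw [crossing, e]
  constructor <;> linarith

lemma tent_crossing : P.tent i (P.crossing i j) = P.tent j (P.crossing i j) := by
  have hk := P.slope_pos i
  obtain ⟨h1, h2⟩ := P.crossing_mem hs hp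
  rw [tent, tent, abs_of_pos (sub_pos.2 h1), abs_of_neg (sub_neg.2 h2), ← hs, crossing]
  field_simp
  ring

/-- Where both densities vanish between the peaks there is no gap between the supports, so that
both tents vanish there. -/
lemma eq_crossing_of_density_eq (hgap : P.left j ≤ P.right i) {c : ℝ}
    (hc : c ∈ Icc (P.peak i) (P.peak j)) (h : P.density i c = P.density j c) :
    c = P.crossing i j := by
  have ht : P.tent i c = P.tent j c := by
    rcases (P.density_nonneg i c).eq_or_lt with h0 | h0
    · have hi : P.rightFoot i ≤ c := by
        by_contra! hcon
        exact h0.not_lt ((P.density_pos_iff i c).2 ⟨(P.leftFoot_lt_peak i).trans_le hc.1, hcon⟩)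
      have hj : c ≤ P.leftFoot j := by
        by_contra! hcon
        rw [h] at h0
        exact h0.not_lt ((P.density_pos_iff j c).2 ⟨hcon, hc.2.trans_lt (P.peak_lt_rightFoot j)⟩)
      rw [left_eq, right_eq] at hgap
      have hji : P.leftFoot j ≤ P.rightFoot i :=
        (le_max_right _ _).trans (hgap.trans (min_le_right _ _))
      have e1 : c - P.peak i = P.peakDensity i / P.slope i := by
        have : c = P.rightFoot i := by linarith
        rw [this, rightFoot]; ring
      have e2 : -(c - P.peak j) = P.peakDensity j / P.slope j := by
        have : c = P.leftFoot j := by linarith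
        rw [this, leftFoot]; ring
      rw [tent, tent, abs_of_nonneg (sub_nonneg.2 hc.1), abs_of_nonpos (sub_nonpos.2 hc.2), e1, e2,
        mul_div_cancel₀ _ (P.slope_pos i).ne', mul_div_cancel₀ _ (P.slope_pos j).ne']
      ring
    · have h1 := (P.density_pos_iff_tent i c).1 h0
      have h2 := (P.density_pos_iff_tent j c).1 (h ▸ h0)
      rwa [density_eq, density_eq, max_eq_right h1.le, max_eq_right h2.le] at h
  rcases lt_trichotomy c (P.crossing i j) with h1 | h1 | h1
  · exact absurd ht (P.tent_lt_tent_of_lt_of_le hs hp h1 (P.tent_crossing hs hp).ge).ne'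
  · exact h1
  · exact absurd ht (P.tent_lt_tent_of_le_of_lt hs hp (P.tent_crossing hs hp).le h1).ne

end TwoAgents

lemma IsUtilitarianCuts.eq_crossing {P : CakeProblem n} (hslope : ∀ i j, P.slope i = P.slope j)
    (hpeak : Function.Injective P.peak) {c : Fin (n + 1) → ℝ} (h : P.IsUtilitarianCuts c)
    (m : Fin n) (hm : m.val + 1 < n) :
    c m.succ = P.crossing (P.byPeak m) (P.byPeak ⟨m.val + 1, hm⟩) :=
  P.eq_crossing_of_density_eq (hslope _ _)
    (P.peak_byPeak_lt hpeak (Fin.lt_def.2 (Nat.lt_succ_self _)))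
    (P.left_byPeak_succ_le hslope hpeak m hm) (h.2.2 m hm).1 (h.2.2 m hm).2

lemma existsUnique_isUtilitarianCuts (hslope : ∀ i j, P.slope i = P.slope j)
    (hpeak : Function.Injective P.peak) :
    ∃! c, P.IsUtilitarianCuts c := by
  have hn := P.numAgents_pos
  have hlt : ∀ (m : Fin n) (hm : m.val + 1 < n), m < ⟨m.val + 1, hm⟩ :=
    fun m hm => Fin.lt_def.2 (Nat.lt_succ_self _)
  refine ⟨Fin.cons 0 fun m : Fin n => if hm : m.val + 1 < n then
    P.crossing (P.byPeak m) (P.byPeak ⟨m.val + 1, hm⟩) else 1, ⟨rfl, ?_, fun m hm => ?_⟩, ?_⟩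
  · have e : Fin.last n = (⟨n - 1, by omega⟩ : Fin n).succ := Fin.ext (by simp; omega)
    rw [e, Fin.cons_succ, dif_neg]
    simp only
    omega
  · rw [Fin.cons_succ, dif_pos hm]
    have hp := P.peak_byPeak_lt hpeak (hlt m hm)
    refine ⟨Ioo_subset_Icc_self (P.crossing_mem (hslope _ _) hp), ?_⟩
    rw [density_eq, density_eq, P.tent_crossing (hslope _ _) hp]
  · intro c hc
    funext k
    refine Fin.cases hc.1 (fun m => ?_) k
    rw [Fin.cons_succ]
    split_ifs with hm
    · exact hc.eq_crossing hslope hpeak m hm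
    · rw [← hc.2.1]
      exact congrArg c (Fin.ext (by simp; omega))

lemma IsUtilitarianCuts.monotone {P : CakeProblem n} {c : Fin (n + 1) → ℝ}
    (h : P.IsUtilitarianCuts c) : Monotone c := by
  refine Fin.monotone_iff_le_succ.2 fun m => ?_
  have hlow : c m.castSucc ≤ P.peak (P.byPeak m) := by
    rcases Nat.eq_zero_or_pos m.val with h0 | h0
    · have e : m.castSucc = 0 := Fin.ext h0
      rw [e, h.1]
      exact (P.peak_mem _).1
    · have h1 : m.val - 1 + 1 < n := by omega
      have := (h.2.2 ⟨m.val - 1, by omega⟩ h1).1.2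
      have e1 : (⟨m.val - 1, by omega⟩ : Fin n).succ = m.castSucc := Fin.ext (by simp; omega)
      have e2 : (⟨m.val - 1 + 1, h1⟩ : Fin n) = m := Fin.ext (by simp; omega)
      rwa [e1, e2] at this
  refine hlow.trans ?_
  by_cases h1 : m.val + 1 < n
  · exact (h.2.2 m h1).1.1
  · have e : m.succ = Fin.last n := Fin.ext (by simp; omega)
    rw [e, h.2.1]
    exact (P.peak_mem _).2

lemma maximizesTotalUtility_of_isUtilitarianCuts (hslope : ∀ i j, P.slope i = P.slope j)
    (hpeak : Function.Injective P.peak)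
    {c : Fin (n + 1) → ℝ}
    (h : P.IsUtilitarianCuts c) : P.MaximizesTotalUtility (P.peakPreserving c) := by
  have hc := h.monotone
  refine P.maximizesTotalUtility_of_density_le
    (P.isAllocation_peakPreserving hc h.1 h.2.1) fun i x hx j => ?_
  obtain ⟨m, rfl⟩ := P.byPeak.surjective i
  obtain ⟨k, rfl⟩ := P.byPeak.surjective j
  replace hx := P.peakPreserving_byPeak_subset c m hx
  refine max_le_max le_rfl ?_
  change P.tent _ x ≤ P.tent _ x
  -- The tents of agents with adjacent peaks meet at the cut between them.
  have hcut : ∀ (t : ℕ) (ht : t + 1 < n), ∃ y, y = c ⟨t + 1, by omega⟩ ∧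
      (x ≤ y → P.tent (P.byPeak ⟨t + 1, ht⟩) x ≤ P.tent (P.byPeak ⟨t, by omega⟩) x) ∧
      (y ≤ x → P.tent (P.byPeak ⟨t, by omega⟩) x ≤ P.tent (P.byPeak ⟨t + 1, ht⟩) x) := by
    intro t ht
    have hp := P.peak_byPeak_lt hpeak
      (show (⟨t, by omega⟩ : Fin n) < ⟨t + 1, ht⟩ from Fin.lt_def.2 (Nat.lt_succ_self _))
    have e := h.eq_crossing hslope hpeak ⟨t, by omega⟩ ht
    have hcr := P.tent_crossing (hslope _ _) hp
    refine ⟨_, e.symm, fun hxy => ?_, fun hxy => ?_⟩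
    · have := P.tent_sub_tent_antitone (hslope _ _) hp hxy
      linarith
    · have := P.tent_sub_tent_antitone (hslope _ _) hp hxy
      linarith
  rcases le_total k m with hkm | hkm
  · have key : ∀ t, k.val ≤ t → ∀ ht : t ≤ m.val,
        P.tent (P.byPeak k) x ≤ P.tent (P.byPeak ⟨t, by omega⟩) x := by
      intro t hkt
      induction t, hkt using Nat.le_induction with
      | base => exact fun _ => le_rfl
      | succ t hkt ih =>
        intro ht
        obtain ⟨y, hy, -, hyx⟩ := hcut t (by omega)
        refine (ih (by omega)).trans (hyx (le_trans ?_ hx.1))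
        rw [hy]
        exact hc (Fin.le_def.2 ht)
    exact key m.val hkm le_rfl
  · have key : ∀ t, m.val ≤ t → ∀ ht : t < n,
        P.tent (P.byPeak ⟨t, ht⟩) x ≤ P.tent (P.byPeak m) x := by
      intro t hmt
      induction t, hmt using Nat.le_induction with
      | base => exact fun _ => le_rfl
      | succ t hmt ih =>
        intro ht
        obtain ⟨y, hy, hxy, -⟩ := hcut t ht
        refine (hxy (hx.2.trans ?_)).trans (ih (by omega))
        rw [hy]
        exact hc (Fin.le_def.2 (by simpa using hmt))
    exact key k.val hkm k.isLt

/-! ### Leftmost leaves -/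

lemma lt_right_of_value_pos (i : Fin n) {y : ℝ} (hy : 0 ≤ y) (h : 0 < P.value i (Ioc y 1)) :
    y < P.right i := by
  obtain ⟨x, hx, hd⟩ := P.exists_density_pos_of_value_pos i h
  exact hx.1.trans_le (P.support_subset i ⟨⟨hy.trans hx.1.le, hx.2.le⟩, hd⟩).2

lemma value_pos_of_lt_right (i : Fin n) {y : ℝ} (h : y < P.right i) :
    0 < P.value i (Ioc y 1) := by
  obtain ⟨x, hx, hxr⟩ := exists_between (max_lt h (P.left_lt_right i))
  rw [max_lt_iff] at hx
  have hx1 : x ≤ 1 := hxr.le.trans (P.right_le_one i)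
  exact P.value_Ioc_pos i ⟨hx.1.le, hx1⟩ (hx.1.trans_le hx1)
    (P.density_pos_of_mem_Ioo i ⟨hx.2, hxr⟩)

/-- A point at which agent `i` leaves with a proper fraction of what remains to the right of `c` has
valuable cake on both sides. -/
lemma value_pos_of_mark (i : Fin n) {c r y : ℝ} (hci : c < P.right i) (hr : 1 < r)
    (hy : y ∈ Icc c 1) (h : P.value i (Icc c y) = P.value i (Icc c 1) / r) :
    0 < P.value i (Ioc c y) ∧ 0 < P.value i (Ioc y 1) := by
  rw [value_Icc, value_Icc] at h
  have hT := P.value_pos_of_lt_right i hci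
  have hadd := P.value_Ioc_add i hy.1 hy.2
  have h1 := div_lt_self hT hr
  refine ⟨h ▸ div_pos hT (by linarith), by linarith⟩

lemma existsUnique_mark (i : Fin n) {c r : ℝ} (hci : c < P.right i) (hr : 1 < r) :
    ∃! y, y ∈ Icc c 1 ∧ P.value i (Icc c y) = P.value i (Icc c 1) / r := by
  have hT := P.value_pos_of_lt_right i hci
  have hc1 : c ≤ 1 := hci.le.trans (P.right_le_one i)
  refine existsUnique_of_exists_of_unique ?_ ?_
  · have hcont : ContinuousOn (fun y => ∫ x in c..y, P.density i x) (Icc c 1) :=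
      (intervalIntegral.continuous_primitive (P.intervalIntegrable_density i) c).continuousOn
    have hmem : P.value i (Ioc c 1) / r ∈
        Icc (∫ x in c..c, P.density i x) (∫ x in c..(1 : ℝ), P.density i x) := by
      rw [intervalIntegral.integral_same, ← P.value_Ioc i hc1]
      exact ⟨(div_pos hT (by linarith)).le, (div_lt_self hT hr).le⟩
    obtain ⟨y, hy, hval⟩ := intermediate_value_Icc hc1 hcont hmem
    refine ⟨y, hy, ?_⟩
    rw [value_Icc, value_Icc, P.value_Ioc i hy.1]
    exact hval
  · have key : ∀ y z, y < z → (y ∈ Icc c 1 ∧ P.value i (Icc c y) = P.value i (Icc c 1) / r) →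
        (z ∈ Icc c 1 ∧ P.value i (Icc c z) = P.value i (Icc c 1) / r) → False := by
      rintro y z hyz ⟨hy, hyv⟩ ⟨hz, hzv⟩
      obtain ⟨h1, -⟩ := P.value_pos_of_mark i hci hr hy hyv
      obtain ⟨-, h2⟩ := P.value_pos_of_mark i hci hr hz hzv
      obtain ⟨x, hx, hxd⟩ := P.exists_density_pos_of_value_pos i h1
      obtain ⟨x', hx', hxd'⟩ := P.exists_density_pos_of_value_pos i h2
      rw [density_pos_iff] at hxd hxd'
      have h3 := P.value_Ioc_pos i (left_mem_Icc.2 hyz.le) hyz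
        ((P.density_pos_iff i y).2 ⟨hxd.1.trans hx.2, by linarith [hx'.1, hxd'.2]⟩)
      have := P.value_Ioc_add i hy.1 hyz.le
      rw [value_Icc] at hyv hzv
      linarith
    intro y z hy hz
    rcases lt_trichotomy y z with h | h | h
    · exact (key y z h hy hz).elim
    · exact h
    · exact (key z y h hz hy).elim

lemma one_lt_sub_of_succ_lt {t : ℕ} (ht : t + 1 < n) : (1 : ℝ) < (n : ℝ) - (t : ℝ) := by
  have : ((t + 1 : ℕ) : ℝ) < n := Nat.cast_lt.2 ht
  push_cast at this
  linarith

section CommonSlope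

variable {P} (hslope : ∀ i j, P.slope i = P.slope j) (hpeak : Function.Injective P.peak)
include hslope hpeak

/-- The next cut is again to the left of the right end of what the next agent values. -/
lemma max_mark_lt_right {m : Fin n} (hm : m.val + 1 < n) {c y : ℝ} (hc : 0 ≤ c)
    (hcm : c < P.right (P.byPeak m)) (hy : y ∈ Icc c 1)
    (h : P.value (P.byPeak m) (Icc c y) =
      P.value (P.byPeak m) (Icc c 1) / ((n : ℝ) - (m.val : ℝ))) :
    max y (P.left (P.byPeak ⟨m.val + 1, hm⟩)) < P.right (P.byPeak ⟨m.val + 1, hm⟩) := by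
  refine max_lt ?_ (P.left_lt_right _)
  have hpos := (P.value_pos_of_mark _ hcm (one_lt_sub_of_succ_lt hm) hy h).2
  exact (P.lt_right_of_value_pos _ (hc.trans hy.1) hpos).trans_le
    (P.right_le_right (hslope _ _)
      (P.peak_byPeak_lt hpeak (Fin.lt_def.2 (Nat.lt_succ_self _))))

lemma IsLeftmostLeavesCuts.lt_right {c : Fin (n + 1) → ℝ} (h : P.IsLeftmostLeavesCuts c)
    (m : Fin n) : 0 ≤ c m.castSucc ∧ c m.castSucc < P.right (P.byPeak m) := by
  have key : ∀ (t : ℕ) (ht : t < n),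
      0 ≤ c (⟨t, ht⟩ : Fin n).castSucc ∧
        c (⟨t, ht⟩ : Fin n).castSucc < P.right (P.byPeak ⟨t, ht⟩) := by
    intro t
    induction t with
    | zero =>
      intro ht
      have e : (⟨0, ht⟩ : Fin n).castSucc = 0 := rfl
      rw [e, h.1]
      exact ⟨le_rfl, (P.left_nonneg _).trans_lt (P.left_lt_right _)⟩
    | succ t ih =>
      intro ht
      obtain ⟨h0, hr⟩ := ih (by omega)
      obtain ⟨y, hy, hval, hmax⟩ := h.2.2 ⟨t, by omega⟩ ht
      change 0 ≤ c (⟨t, by omega⟩ : Fin n).succ ∧ c (⟨t, by omega⟩ : Fin n).succ < _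
      rw [hmax]
      exact ⟨(h0.trans hy.1).trans (le_max_left _ _),
        max_mark_lt_right hslope hpeak (m := ⟨t, by omega⟩) ht h0 hr hy hval⟩
  exact key m.val m.isLt

lemma IsLeftmostLeavesCuts.unique {c c' : Fin (n + 1) → ℝ} (h : P.IsLeftmostLeavesCuts c)
    (h' : P.IsLeftmostLeavesCuts c') : c = c' := by
  funext k
  induction k using Fin.induction with
  | zero => rw [h.1, h'.1]
  | succ m ih =>
    by_cases hm : m.val + 1 < n
    · obtain ⟨y, hy, hval, hmax⟩ := h.2.2 m hm
      obtain ⟨y', hy', hval', hmax'⟩ := h'.2.2 m hm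
      obtain ⟨h0, hr⟩ := h.lt_right hslope hpeak m
      rw [← ih] at hy' hval'
      rw [hmax, hmax', (P.existsUnique_mark _ hr (one_lt_sub_of_succ_lt hm)).unique
        ⟨hy, hval⟩ ⟨hy', hval'⟩]
    · have e : m.succ = Fin.last n := Fin.ext (by simp; omega)
      rw [e, h.2.1, h'.2.1]

lemma exists_isLeftmostLeavesCuts : ∃ c, P.IsLeftmostLeavesCuts c := by
  have hex : ∀ (m : Fin n) (c : ℝ), ∃ y, 0 ≤ c → c < P.right (P.byPeak m) → m.val + 1 < n →
      y ∈ Icc c 1 ∧ P.value (P.byPeak m) (Icc c y) =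
        P.value (P.byPeak m) (Icc c 1) / ((n : ℝ) - (m.val : ℝ)) := by
    intro m c
    by_cases hcond : 0 ≤ c ∧ c < P.right (P.byPeak m) ∧ m.val + 1 < n
    · obtain ⟨y, hy, -⟩ :=
        P.existsUnique_mark _ hcond.2.1 (one_lt_sub_of_succ_lt hcond.2.2)
      exact ⟨y, fun _ _ _ => hy⟩
    · exact ⟨0, fun h1 h2 h3 => (hcond ⟨h1, h2, h3⟩).elim⟩
  choose F hF using hex
  let C : ℕ → ℝ := fun t => Nat.rec 0 (fun t c => if ht : t + 1 < n then
    max (F ⟨t, by omega⟩ c) (P.left (P.byPeak ⟨t + 1, ht⟩)) else 1) t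
  have hC : ∀ (t : ℕ) (ht : t + 1 < n),
      C (t + 1) = max (F ⟨t, by omega⟩ (C t)) (P.left (P.byPeak ⟨t + 1, ht⟩)) :=
    fun t ht => dif_pos ht
  have key : ∀ (t : ℕ) (ht : t < n), 0 ≤ C t ∧ C t < P.right (P.byPeak ⟨t, ht⟩) := by
    intro t
    induction t with
    | zero => exact fun _ => ⟨le_rfl, (P.left_nonneg _).trans_lt (P.left_lt_right _)⟩
    | succ t ih =>
      intro ht
      obtain ⟨h0, hr⟩ := ih (by omega)
      obtain ⟨hy, hval⟩ := hF ⟨t, by omega⟩ (C t) h0 hr ht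
      rw [hC t ht]
      exact ⟨(h0.trans hy.1).trans (le_max_left _ _),
        max_mark_lt_right hslope hpeak (m := ⟨t, by omega⟩) ht h0 hr hy hval⟩
  refine ⟨fun k => C k.val, rfl, ?_, fun m hm => ?_⟩
  · obtain ⟨t, rfl⟩ : ∃ t, n = t + 1 := ⟨n - 1, by have := P.numAgents_pos; omega⟩
    exact dif_neg (lt_irrefl _)
  · obtain ⟨h0, hr⟩ := key m.val m.isLt
    obtain ⟨hy, hval⟩ := hF m (C m.val) h0 hr hm
    exact ⟨F m (C m.val), hy, hval, hC m.val hm⟩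

lemma IsLeftmostLeavesCuts.monotone {c : Fin (n + 1) → ℝ} (h : P.IsLeftmostLeavesCuts c) :
    Monotone c := by
  refine Fin.monotone_iff_le_succ.2 fun m => ?_
  by_cases hm : m.val + 1 < n
  · obtain ⟨y, hy, -, hmax⟩ := h.2.2 m hm
    rw [hmax]
    exact hy.1.trans (le_max_left _ _)
  · have e : m.succ = Fin.last n := Fin.ext (by simp; omega)
    rw [e, h.2.1]
    exact (h.lt_right hslope hpeak m).2.le.trans (P.right_le_one _)

lemma IsLeftmostLeavesCuts.isParetoOptimal {c : Fin (n + 1) → ℝ}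
    (h : P.IsLeftmostLeavesCuts c) : P.IsParetoOptimal (P.peakPreserving c) := by
  refine P.isParetoOptimal_peakPreserving hslope hpeak (h.monotone hslope hpeak) h.1 h.2.1
    fun m hm => ?_
  obtain ⟨y, hy, hval, hmax⟩ := h.2.2 m hm
  obtain ⟨h0, hr⟩ := h.lt_right hslope hpeak m
  have hpos := (P.value_pos_of_mark _ hr (one_lt_sub_of_succ_lt hm) hy hval).2
  rw [hmax]
  exact ⟨le_max_right _ _, max_le (P.lt_right_of_value_pos _ (h0.trans hy.1) hpos).le
    (P.left_byPeak_succ_le hslope hpeak m hm)⟩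

/-- When the `m`-th agent is up, what remains is worth at least `(n - m) / n` to them: the previous
agent left at least the corresponding share in their own eyes, and what is left over is worth more
to the next agent by stochastic dominance. -/
lemma IsLeftmostLeavesCuts.le_value_rest {c : Fin (n + 1) → ℝ} (h : P.IsLeftmostLeavesCuts c)
    (m : Fin n) :
    ((n : ℝ) - (m.val : ℝ)) / n ≤ P.value (P.byPeak m) (Ioc (c m.castSucc) 1) ∧
      (0 < m.val →
        ((n : ℝ) - (m.val : ℝ)) / n < P.value (P.byPeak m) (Ioc (c m.castSucc) 1)) := by
  have hn : (0 : ℝ) < n := Nat.cast_pos.2 P.numAgents_pos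
  have key : ∀ (t : ℕ) (ht : t < n),
      ((n : ℝ) - (t : ℝ)) / n ≤ P.value (P.byPeak ⟨t, ht⟩) (Ioc (c ⟨t, by omega⟩) 1) ∧
      (0 < t →
        ((n : ℝ) - (t : ℝ)) / n < P.value (P.byPeak ⟨t, ht⟩) (Ioc (c ⟨t, by omega⟩) 1)) := by
    intro t
    induction t with
    | zero =>
      intro ht
      have e : (⟨0, by omega⟩ : Fin (n + 1)) = 0 := rfl
      rw [e, h.1, value_Ioc_zero_one, Nat.cast_zero, sub_zero, div_self hn.ne']
      exact ⟨le_rfl, fun h => absurd h (lt_irrefl _)⟩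
    | succ t ih =>
      intro ht
      have ht' : t < n := by omega
      suffices hlt : ((n : ℝ) - ((t + 1 : ℕ) : ℝ)) / n <
          P.value (P.byPeak ⟨t + 1, ht⟩) (Ioc (c ⟨t + 1, by omega⟩) 1) from
        ⟨hlt.le, fun _ => hlt⟩
      have ih1 := (ih ht').1
      obtain ⟨h0, hr⟩ := h.lt_right hslope hpeak ⟨t, ht'⟩
      obtain ⟨y, hy, hval, hmax⟩ := h.2.2 ⟨t, ht'⟩ ht
      have e : (⟨t, ht'⟩ : Fin n).castSucc = ⟨t, by omega⟩ := rfl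
      have e' : (⟨t, ht'⟩ : Fin n).succ = ⟨t + 1, by omega⟩ := rfl
      rw [e] at hval hy h0 hr
      rw [e'] at hmax
      have h2 := one_lt_sub_of_succ_lt ht
      obtain ⟨hv1, hv2⟩ := P.value_pos_of_mark _ hr h2 hy hval
      rw [hmax]
      rcases le_total y (P.left (P.byPeak ⟨t + 1, ht⟩)) with hyl | hyl
      · rw [max_eq_right hyl, value_Ioc_left_one, div_lt_one hn]
        push_cast
        have := t.cast_nonneg (α := ℝ)
        linarith
      · rw [max_eq_left hyl]
        have hv0 := P.value_mono (P.byPeak ⟨t, ht'⟩)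
          (Ioc_subset_Icc_self.trans (Icc_subset_Icc le_rfl hy.2)) (Ioc_subset_Ioc_left h0)
        have hsd := P.value_Ioc_one_lt (hslope _ _)
          (P.peak_byPeak_lt hpeak
            (show (⟨t, ht'⟩ : Fin n) < ⟨t + 1, ht⟩ from Fin.lt_def.2 (Nat.lt_succ_self _)))
          ⟨h0.trans hy.1, hy.2⟩ (hv1.trans_le hv0) hv2
        refine lt_of_le_of_lt ?_ hsd
        have hadd := P.value_Ioc_add (P.byPeak ⟨t, ht'⟩) hy.1 hy.2
        rw [value_Icc, value_Icc, ← hadd] at hval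
        rw [← hadd] at ih1
        set u := P.value (P.byPeak ⟨t, ht'⟩) (Ioc (c ⟨t, by omega⟩) y)
        set w := P.value (P.byPeak ⟨t, ht'⟩) (Ioc y 1)
        push_cast
        change u = (u + w) / ((n : ℝ) - (t : ℝ)) at hval
        rw [eq_div_iff (by linarith)] at hval
        rw [div_le_iff₀ hn] at ih1 ⊢
        -- With `r = n - t`: from `u * r = u + w` and `r ≤ (u + w) * n` follows `r - 1 ≤ w * n`.
        have h3 : (n : ℝ) - t ≤ u * n * (n - t) := by linear_combination ih1 - n * hval
        have h4 : 1 ≤ u * n := by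
          by_contra! hcon
          nlinarith
        have h5 : w * n = u * n * (n - t - 1) := by linear_combination -n * hval
        rw [h5]
        nlinarith
  exact key m.val m.isLt

lemma IsLeftmostLeavesCuts.inv_le_value {c : Fin (n + 1) → ℝ} (h : P.IsLeftmostLeavesCuts c)
    (m : Fin n) :
    1 / (n : ℝ) ≤ P.value (P.byPeak m) (P.peakPreserving c (P.byPeak m)) ∧
      (0 < m.val → 1 / (n : ℝ) < P.value (P.byPeak m) (P.peakPreserving c (P.byPeak m))) := by
  have hmn : (0 : ℝ) < (n : ℝ) - m.val := sub_pos.2 (Nat.cast_lt.2 m.isLt)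
  have hle : P.value (P.byPeak m) (Ioc (c m.castSucc) 1) / ((n : ℝ) - m.val) ≤
      P.value (P.byPeak m) (P.peakPreserving c (P.byPeak m)) := by
    rw [value_peakPreserving_byPeak]
    by_cases hm : m.val + 1 < n
    · obtain ⟨y, hy, hval, hmax⟩ := h.2.2 m hm
      have h1 := P.value_Ioc_add (P.byPeak m) hy.1 (hmax ▸ le_max_left _ _ : y ≤ c m.succ)
      rw [value_Icc, value_Icc] at hval
      rw [← hval, ← h1]
      linarith [P.value_nonneg (P.byPeak m) (Ioc y (c m.succ))]
    · have e : m.succ = Fin.last n := Fin.ext (by simp; omega)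
      have e2 : (n : ℝ) - m.val = 1 := by
        have : n = m.val + 1 := by omega
        have h3 : (n : ℝ) = ((m.val + 1 : ℕ) : ℝ) := congrArg _ this
        rw [h3]; push_cast; ring
      rw [e, h.2.1, e2, div_one]
  have e3 : 1 / (n : ℝ) = ((n : ℝ) - m.val) / n / ((n : ℝ) - m.val) := by
    field_simp
  obtain ⟨h1, h2⟩ := h.le_value_rest hslope hpeak m
  rw [e3]
  exact ⟨(div_le_div_of_nonneg_right h1 hmn.le).trans hle,
    fun h0 => (div_lt_div_of_pos_right (h2 h0) hmn).trans_le hle⟩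

end CommonSlope

/-! ### Elementary pieces -/

lemma finite_breakpoints : P.breakpoints.Finite :=
  (((toFinite {0, 1}).union (finite_range _)).union (finite_range _)).union (finite_range _)

lemma breakpoints_subset : P.breakpoints ⊆ Icc 0 1 := by
  rintro x (((hx | ⟨i, rfl⟩) | ⟨i, rfl⟩) | ⟨i, rfl⟩)
  · rcases hx with rfl | rfl <;> simp
  · exact ⟨P.left_nonneg i, (P.left_lt_right i).le.trans (P.right_le_one i)⟩
  · exact P.peak_mem i
  · exact ⟨(P.left_nonneg i).trans (P.left_lt_right i).le, P.right_le_one i⟩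

lemma zero_mem_breakpoints : 0 ∈ P.breakpoints := by simp [breakpoints]

lemma one_mem_breakpoints : 1 ∈ P.breakpoints := by simp [breakpoints]

lemma left_mem_breakpoints (i : Fin n) : P.left i ∈ P.breakpoints :=
  Or.inl (Or.inl (Or.inr ⟨i, rfl⟩))

lemma peak_mem_breakpoints (i : Fin n) : P.peak i ∈ P.breakpoints := Or.inl (Or.inr ⟨i, rfl⟩)

lemma right_mem_breakpoints (i : Fin n) : P.right i ∈ P.breakpoints := Or.inr ⟨i, rfl⟩

variable {P} in
lemma IsElementary.nonneg {a b : ℝ} (h : P.IsElementary a b) : 0 ≤ a := (P.breakpoints_subset h.1).1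

variable {P} in
lemma IsElementary.le_one {a b : ℝ} (h : P.IsElementary a b) : b ≤ 1 :=
  (P.breakpoints_subset h.2.1).2

variable {P} in
lemma IsElementary.Icc_subset {a b : ℝ} (h : P.IsElementary a b) : Icc a b ⊆ Icc 0 1 :=
  Icc_subset_Icc h.nonneg h.le_one

variable {P} in
lemma IsElementary.eq_or_le {a b a' b' : ℝ} (h : P.IsElementary a b) (h' : P.IsElementary a' b') :
    (a = a' ∧ b = b') ∨ b ≤ a' ∨ b' ≤ a := by
  have h1 := h.2.2.2 a' h'.1
  have h2 := h.2.2.2 b' h'.2.1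
  have h3 := h'.2.2.2 a h.1
  have h4 := h'.2.2.2 b h.2.1
  have h5 := h.2.2.1
  have h6 := h'.2.2.1
  grind

lemma exists_isElementary_zero : ∃ b, P.IsElementary 0 b := by
  obtain ⟨b, hb, hmin⟩ := exists_min_image (P.breakpoints ∩ Ioi 0) id
    (P.finite_breakpoints.inter_of_left _) ⟨1, P.one_mem_breakpoints, mem_Ioi.2 one_pos⟩
  refine ⟨b, P.zero_mem_breakpoints, hb.1, hb.2, fun t ht => ?_⟩
  rcases le_or_gt t 0 with h | h
  · exact Or.inl h
  · exact Or.inr (hmin t ⟨ht, h⟩)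

lemma exists_isElementary_mem {x : ℝ} (hx : x ∈ Ioc (0 : ℝ) 1) :
    ∃ a b, P.IsElementary a b ∧ x ∈ Ioc a b := by
  obtain ⟨a, ha, hmax⟩ := exists_max_image (P.breakpoints ∩ Iio x) id
    (P.finite_breakpoints.inter_of_left _) ⟨0, P.zero_mem_breakpoints, hx.1⟩
  obtain ⟨b, hb, hmin⟩ := exists_min_image (P.breakpoints ∩ Ici x) id
    (P.finite_breakpoints.inter_of_left _) ⟨1, P.one_mem_breakpoints, hx.2⟩
  refine ⟨a, b, ⟨ha.1, hb.1, lt_of_lt_of_le ha.2 hb.2, fun t ht => ?_⟩, ha.2, hb.2⟩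
  rcases lt_or_ge t x with h | h
  · exact Or.inl (hmax t ⟨ht, h⟩)
  · exact Or.inr (hmin t ⟨ht, h⟩)

lemma finite_setOf_isElementary : {q : ℝ × ℝ | P.IsElementary q.1 q.2}.Finite :=
  (P.finite_breakpoints.prod P.finite_breakpoints).subset fun _ hq => ⟨hq.1, hq.2.1⟩

/-- The finite set of the pairs of endpoints of elementary pieces. -/
noncomputable def elementaryPieces : Finset (ℝ × ℝ) := P.finite_setOf_isElementary.toFinset

lemma mem_elementaryPieces {q : ℝ × ℝ} :
    q ∈ P.elementaryPieces ↔ P.IsElementary q.1 q.2 := by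
  simp [elementaryPieces]

lemma sum_value_elementaryPieces (i : Fin n) :
    ∑ q ∈ P.elementaryPieces, P.value i (Ioc q.1 q.2) = 1 := by
  have h : Ioc (0 : ℝ) 1 = ⋃ q ∈ P.elementaryPieces, Ioc q.1 q.2 := by
    ext x
    simp only [mem_iUnion, mem_elementaryPieces, exists_prop, Prod.exists]
    constructor
    · exact P.exists_isElementary_mem
    · rintro ⟨a, b, hab, hx⟩
      exact ⟨hab.nonneg.trans_lt hx.1, hx.2.trans hab.le_one⟩
  rw [← P.value_Ioc_zero_one i, h]
  refine (integral_biUnion_finset _ (fun _ _ => measurableSet_Ioc) ?_ fun q hq => ?_).symm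
  · intro q hq q' hq' hne
    rw [Finset.mem_coe, mem_elementaryPieces] at hq hq'
    rcases hq.eq_or_le hq' with h | h | h
    · exact absurd (Prod.ext h.1 h.2) hne
    · exact Set.disjoint_left.2 fun x hx hx' => absurd (hx.2.trans h) (not_le.2 hx'.1)
    · exact Set.disjoint_left.2 fun x hx hx' => absurd (hx'.2.trans h) (not_le.2 hx.1)
  · rw [mem_elementaryPieces] at hq
    exact P.integrableOn_density i (Ioc_subset_Icc_self.trans hq.Icc_subset)

lemma mem_interested {i : Fin n} {a b : ℝ} :
    i ∈ P.interested a b ↔ (P.support i ∩ Icc a b).Nonempty := by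
  simp [interested]

variable {P} in
lemma IsElementary.mem_interested_iff {a b : ℝ} (h : P.IsElementary a b) {i : Fin n} :
    i ∈ P.interested a b ↔ P.left i ≤ a ∧ b ≤ P.right i := by
  rw [mem_interested]
  constructor
  · rintro ⟨x, hxs, hx⟩
    have hd := (P.density_pos_iff i x).1 hxs.2
    have h1 := P.support_subset i hxs
    constructor
    · refine (h.2.2.2 _ (P.left_mem_breakpoints i)).resolve_right fun hb => ?_
      rw [left_eq] at hb
      rcases le_max_iff.1 hb with hb | hb
      · linarith [h.nonneg, h.2.2.1]
      · linarith [hx.2]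
    · refine (h.2.2.2 _ (P.right_mem_breakpoints i)).resolve_left fun hb => ?_
      rw [right_eq] at hb
      rcases min_le_iff.1 hb with hb | hb
      · linarith [h.le_one, h.2.2.1]
      · linarith [hx.1]
  · rintro ⟨hl, hr⟩
    have hab := h.2.2.1
    have hmem : (a + b) / 2 ∈ Icc a b := ⟨by linarith, by linarith⟩
    exact ⟨(a + b) / 2, ⟨h.Icc_subset hmem, P.density_pos_of_mem_Ioo i
      ⟨by linarith, by linarith⟩⟩, hmem⟩

variable {P} in
lemma IsElementary.interested_nonempty {a b : ℝ} (h : P.IsElementary a b) :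
    (P.interested a b).Nonempty := by
  have hab := h.2.2.1
  have hmem : (a + b) / 2 ∈ Icc a b := ⟨by linarith, by linarith⟩
  obtain ⟨i, hi⟩ := P.exists_mem_Icc_left_right (h.Icc_subset hmem)
  refine ⟨i, h.mem_interested_iff.2 ⟨?_, ?_⟩⟩
  · refine (h.2.2.2 _ (P.left_mem_breakpoints i)).resolve_right fun hb => ?_
    linarith [hi.1]
  · refine (h.2.2.2 _ (P.right_mem_breakpoints i)).resolve_left fun hb => ?_
    linarith [hi.2]

variable {P} in
lemma IsElementary.density_eq_zero {a b : ℝ} (h : P.IsElementary a b) {i : Fin n}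
    (hi : i ∉ P.interested a b) {x : ℝ} (hx : x ∈ Icc a b) : P.density i x = 0 := by
  by_contra hne
  exact hi (P.mem_interested.2 ⟨x, ⟨h.Icc_subset hx,
    (P.density_nonneg i x).lt_of_ne (Ne.symm hne)⟩, hx⟩)

variable {P} in
lemma IsElementary.value_eq_zero {a b : ℝ} (h : P.IsElementary a b) {i : Fin n}
    (hi : i ∉ P.interested a b) : P.value i (Ioc a b) = 0 :=
  setIntegral_eq_zero_of_forall_eq_zero
    fun _ hx => h.density_eq_zero hi (Ioc_subset_Icc_self hx)

variable {P} in
lemma IsElementary.value_pos {a b : ℝ} (h : P.IsElementary a b) {i : Fin n}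
    (hi : i ∈ P.interested a b) : 0 < P.value i (Ioc a b) := by
  obtain ⟨x, hxs, hx⟩ := P.mem_interested.1 hi
  exact P.value_Ioc_pos i hx h.2.2.1 hxs.2

lemma tent_nonneg (i : Fin n) {x : ℝ} (hl : P.leftFoot i ≤ x) (hr : x ≤ P.rightFoot i) :
    0 ≤ P.tent i x := by
  rw [tent, sub_nonneg, ← le_div_iff₀' (P.slope_pos i), abs_le]
  rw [leftFoot] at hl
  rw [rightFoot] at hr
  constructor <;> linarith

variable {P} in
lemma IsElementary.density_affine {a b : ℝ} (h : P.IsElementary a b) (i : Fin n) :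
    ∃ α β : ℝ, ∀ x ∈ Icc a b, P.density i x = α + β * x := by
  by_cases hi : i ∈ P.interested a b
  · rw [h.mem_interested_iff, left_eq, right_eq] at hi
    have ht : ∀ x ∈ Icc a b, P.density i x = P.tent i x := fun x hx =>
      max_eq_right (P.tent_nonneg i ((le_max_right _ _).trans (hi.1.trans hx.1))
        (hx.2.trans (hi.2.trans (min_le_right _ _))))
    rcases h.2.2.2 _ (P.peak_mem_breakpoints i) with hp | hp
    · refine ⟨P.peakDensity i + P.slope i * P.peak i, -P.slope i, fun x hx => ?_⟩
      rw [ht x hx, tent, abs_of_nonneg (sub_nonneg.2 (hp.trans hx.1))]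
      ring
    · refine ⟨P.peakDensity i - P.slope i * P.peak i, P.slope i, fun x hx => ?_⟩
      rw [ht x hx, tent, abs_of_nonpos (sub_nonpos.2 (hx.2.trans hp))]
      ring
  · exact ⟨0, 0, fun x hx => by rw [h.density_eq_zero hi hx]; ring⟩

/-! ### Parts of elementary pieces -/

lemma part_subset_Icc (a b : ℝ) (N m : ℕ) :
    part a b N m ⊆ Icc (a + (m : ℝ) * ((b - a) / (2 * (N : ℝ))))
      (a + ((m : ℝ) + 1) * ((b - a) / (2 * (N : ℝ)))) := by
  simp only [part]
  split_ifs
  exacts [subset_rfl, Ioc_subset_Icc_self]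

lemma Ioc_subset_part (a b : ℝ) (N m : ℕ) :
    Ioc (a + (m : ℝ) * ((b - a) / (2 * (N : ℝ))))
      (a + ((m : ℝ) + 1) * ((b - a) / (2 * (N : ℝ)))) ⊆ part a b N m := by
  simp only [part]
  split_ifs
  exacts [Ioc_subset_Icc_self, subset_rfl]

lemma ordConnected_part (a b : ℝ) (N m : ℕ) : (part a b N m).OrdConnected := by
  simp only [part]
  split_ifs
  exacts [ordConnected_Icc, ordConnected_Ioc]

lemma value_part (i : Fin n) (a b : ℝ) (N m : ℕ) :
    P.value i (part a b N m) = P.value i (Ioc (a + (m : ℝ) * ((b - a) / (2 * (N : ℝ))))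
      (a + ((m : ℝ) + 1) * ((b - a) / (2 * (N : ℝ))))) := by
  simp only [part]
  split_ifs
  exacts [P.value_Icc i _ _, rfl]

lemma le_end_of_mem_part {a b : ℝ} (hab : a < b) {N m : ℕ} (hm : m < 2 * N) {x : ℝ}
    (hx : x ∈ part a b N m) : x ≤ b := by
  refine (part_subset_Icc a b N m hx).2.trans ?_
  have hN : (0 : ℝ) < N := Nat.cast_pos.2 (by omega)
  have h1 : (m : ℝ) + 1 ≤ 2 * N := by exact_mod_cast hm
  have h2 : (2 * (N : ℝ)) * ((b - a) / (2 * N)) = b - a := by field_simp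
  have h3 := mul_le_mul_of_nonneg_right h1
    (div_nonneg (sub_nonneg.2 hab.le) (by positivity : (0 : ℝ) ≤ 2 * N))
  linarith

lemma start_le_of_mem_part {a b : ℝ} (hab : a < b) {N m : ℕ} {x : ℝ}
    (hx : x ∈ part a b N m) : a ≤ x := by
  refine le_trans ?_ (part_subset_Icc a b N m hx).1
  have : 0 ≤ (m : ℝ) * ((b - a) / (2 * (N : ℝ))) :=
    mul_nonneg m.cast_nonneg (div_nonneg (sub_nonneg.2 hab.le) (by positivity))
  linarith

lemma part_subset {a b : ℝ} (hab : a < b) {N m : ℕ} (hm : m < 2 * N) :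
    part a b N m ⊆ Icc a b :=
  fun _ hx => ⟨start_le_of_mem_part hab hx, le_end_of_mem_part hab hm hx⟩

/-- A part whose starting point is positive does not contain this point. -/
lemma lt_of_mem_part {a b : ℝ} {N m : ℕ} (h0 : 0 < a + (m : ℝ) * ((b - a) / (2 * (N : ℝ)))) {x : ℝ}
    (hx : x ∈ part a b N m) : a + (m : ℝ) * ((b - a) / (2 * (N : ℝ))) < x := by
  simp only [part, if_neg h0.ne'] at hx
  exact hx.1

lemma disjoint_part_of_lt {a b : ℝ} (ha : 0 ≤ a) (hab : a < b) {N m m' : ℕ} (hN : 0 < N)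
    (hm : m < m') : Disjoint (part a b N m) (part a b N m') := by
  have hd : 0 < (b - a) / (2 * (N : ℝ)) := div_pos (sub_pos.2 hab) (by positivity)
  have hm' : (m : ℝ) + 1 ≤ m' := by exact_mod_cast hm
  have h1 := mul_le_mul_of_nonneg_right hm' hd.le
  refine Set.disjoint_left.2 fun x hx hx' => ?_
  have h2 := (part_subset_Icc a b N m hx).2
  have h3 : 0 < (m' : ℝ) * ((b - a) / (2 * (N : ℝ))) :=
    mul_pos (by have := m.cast_nonneg (α := ℝ); linarith) hd
  have h4 := lt_of_mem_part (by linarith) hx'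
  linarith

lemma disjoint_part_of_le {a b a' b' : ℝ} (ha : 0 ≤ a) (hab : a < b) (hab' : a' < b')
    (h : b ≤ a') {N N' m m' : ℕ} (hm : m < 2 * N) :
    Disjoint (part a b N m) (part a' b' N' m') := by
  refine Set.disjoint_left.2 fun x hx hx' => ?_
  have h1 := le_end_of_mem_part hab hm hx
  have h2 : 0 ≤ (m' : ℝ) * ((b' - a') / (2 * (N' : ℝ))) :=
    mul_nonneg m'.cast_nonneg (div_nonneg (sub_nonneg.2 hab'.le) (by positivity))
  have h3 := lt_of_mem_part (by linarith) hx'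
  linarith

lemma disjoint_part {a b a' b' : ℝ} (h : P.IsElementary a b) (h' : P.IsElementary a' b')
    (K : ℝ → ℝ → ℕ) {m m' : ℕ} (hm : m < 2 * K a b) (hm' : m' < 2 * K a' b')
    (hne : ¬ (a = a' ∧ b = b' ∧ m = m')) :
    Disjoint (part a b (K a b) m) (part a' b' (K a' b') m') := by
  rcases h.eq_or_le h' with ⟨rfl, rfl⟩ | hle | hle
  · rcases lt_trichotomy m m' with hlt | rfl | hlt
    · exact disjoint_part_of_lt h.nonneg h.2.2.1 (by omega) hlt
    · exact absurd ⟨rfl, rfl, rfl⟩ hne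
    · exact (disjoint_part_of_lt h.nonneg h.2.2.1 (by omega) hlt).symm
  · exact disjoint_part_of_le h.nonneg h.2.2.1 h'.2.2.1 hle hm
  · exact (disjoint_part_of_le h'.nonneg h'.2.2.1 h.2.2.1 hle hm').symm

lemma exists_mem_part {a b : ℝ} (hab : a < b) {N : ℕ} (hN : 0 < N) {x : ℝ} (hx : x ∈ Ioc a b) :
    ∃ m < 2 * N, x ∈ part a b N m := by
  have hd : 0 < (b - a) / (2 * (N : ℝ)) := div_pos (sub_pos.2 hab) (by positivity)
  have hpos : 0 < (x - a) / ((b - a) / (2 * (N : ℝ))) := div_pos (sub_pos.2 hx.1) hd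
  obtain ⟨m, hm⟩ := Nat.exists_eq_succ_of_ne_zero (Nat.ceil_pos.2 hpos).ne'
  have h1 : (x - a) / ((b - a) / (2 * (N : ℝ))) ≤ m + 1 := by
    have := Nat.le_ceil ((x - a) / ((b - a) / (2 * (N : ℝ))))
    rw [hm] at this
    exact_mod_cast this
  have h2 : (m : ℝ) < (x - a) / ((b - a) / (2 * (N : ℝ))) := Nat.lt_ceil.1 (by omega)
  have h3 : (x - a) / ((b - a) / (2 * (N : ℝ))) ≤ 2 * N := by
    rw [div_le_iff₀ hd, mul_div_cancel₀ _ (by positivity)]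
    linarith [hx.2]
  rw [div_le_iff₀ hd] at h1
  refine ⟨m, ?_, Ioc_subset_part a b N m ⟨?_, by linarith⟩⟩
  · exact_mod_cast h2.trans_le h3
  · rw [lt_div_iff₀ hd] at h2
    linarith

lemma zero_mem_part (b : ℝ) (hb : 0 < b) (N : ℕ) : (0 : ℝ) ∈ part 0 b N 0 := by
  have : 0 ≤ b / (2 * (N : ℝ)) := div_nonneg hb.le (by positivity)
  simpa [part] using this

/-- Two parts of an elementary piece that lie symmetrically to its midpoint are together worth the
same as two parts of average value, because the density is affine on the piece. -/
lemma value_part_add_value_part {a b : ℝ} (h : P.IsElementary a b) (i : Fin n) {N m : ℕ}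
    (hm : m < N) :
    P.value i (part a b N m) + P.value i (part a b N (2 * N - 1 - m)) =
      P.value i (Ioc a b) / N := by
  obtain ⟨α, β, hαβ⟩ := h.density_affine i
  have hab := h.2.2.1
  have hN : (0 : ℝ) < N := Nat.cast_pos.2 (by omega)
  have hval : ∀ u v, a ≤ u → u ≤ v → v ≤ b →
      P.value i (Ioc u v) = α * (v - u) + β * ((v ^ 2 - u ^ 2) / 2) := by
    intro u v hu huv hv
    rw [P.value_Ioc i huv, intervalIntegral.integral_congr (g := fun x => α + β * x)]
    · have hi : IntervalIntegrable (fun x => β * x) volume u v :=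
        (continuous_const.mul continuous_id).intervalIntegrable _ _
      rw [intervalIntegral.integral_add intervalIntegrable_const hi,
        intervalIntegral.integral_const, intervalIntegral.integral_const_mul, integral_id]
      simp only [smul_eq_mul]
      ring
    · intro x hx
      rw [uIcc_of_le huv] at hx
      exact hαβ x ⟨hu.trans hx.1, hx.2.trans hv⟩
  have hbounds : ∀ k : ℕ, k < 2 * N →
      a ≤ a + (k : ℝ) * ((b - a) / (2 * (N : ℝ))) ∧
      a + (k : ℝ) * ((b - a) / (2 * (N : ℝ))) ≤ a + ((k : ℝ) + 1) * ((b - a) / (2 * (N : ℝ))) ∧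
      a + ((k : ℝ) + 1) * ((b - a) / (2 * (N : ℝ))) ≤ b := by
    intro k hk
    have hd : 0 < (b - a) / (2 * (N : ℝ)) := div_pos (sub_pos.2 hab) (by positivity)
    have h1 : (k : ℝ) + 1 ≤ 2 * N := by exact_mod_cast hk
    have h2 : (2 * (N : ℝ)) * ((b - a) / (2 * N)) = b - a := by field_simp
    have h3 := mul_le_mul_of_nonneg_right h1 hd.le
    have h4 := mul_nonneg k.cast_nonneg hd.le (a := (k : ℝ))
    refine ⟨by linarith, by linarith, by linarith⟩
  obtain ⟨b1, b2, b3⟩ := hbounds m (by omega)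
  obtain ⟨b4, b5, b6⟩ := hbounds (2 * N - 1 - m) (by omega)
  rw [value_part, value_part, hval _ _ b1 b2 b3, hval _ _ b4 b5 b6, hval a b le_rfl hab.le le_rfl]
  have hcast : ((2 * N - 1 - m : ℕ) : ℝ) = 2 * N - 1 - m := by
    have e : 2 * N - 1 - m + m + 1 = 2 * N := by omega
    have : ((2 * N - 1 - m : ℕ) : ℝ) + m + 1 = 2 * N := by exact_mod_cast e
    linarith
  rw [hcast]
  field_simp
  ring

/-! ### Shares of symmetric parts -/

lemma card_filter_lt_lt_card {I : Finset (Fin n)} {i : Fin n} (hi : i ∈ I) :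
    (I.filter (· < i)).card < I.card :=
  Finset.card_lt_card (Finset.filter_ssubset.2 ⟨i, hi, lt_irrefl i⟩)

lemma card_filter_lt_injOn (I : Finset (Fin n)) :
    InjOn (fun i => (I.filter (· < i)).card) I := by
  have key : ∀ i ∈ I, ∀ j, i < j → (I.filter (· < i)).card < (I.filter (· < j)).card := by
    intro i hi j hij
    refine Finset.card_lt_card (Finset.ssubset_iff_of_subset ?_ |>.2 ⟨i, ?_, ?_⟩)
    · exact fun k hk => by
        rw [Finset.mem_filter] at hk ⊢
        exact ⟨hk.1, hk.2.trans hij⟩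
    · exact Finset.mem_filter.2 ⟨hi, hij⟩
    · exact fun h => lt_irrefl _ (Finset.mem_filter.1 h).2
  intro i hi j hj hij
  rcases lt_trichotomy i j with h | h | h
  · exact absurd hij (key i hi j h).ne
  · exact h
  · exact absurd hij (key j hj i h).ne'

lemma exists_card_filter_lt_eq {I : Finset (Fin n)} {t : ℕ} (ht : t < I.card) :
    ∃ i ∈ I, (I.filter (· < i)).card = t := by
  have hs : SurjOn (fun i => (I.filter (· < i)).card) I (Finset.range I.card) :=
    Finset.surjOn_of_injOn_of_card_le _
      (fun i hi => by simpa using card_filter_lt_lt_card hi) (card_filter_lt_injOn I) (by simp)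
  obtain ⟨i, hi, h⟩ := hs (by simpa using ht)
  exact ⟨i, hi, h⟩

lemma isAllocation_symmetricShares {I : ℝ → ℝ → Finset (Fin n)}
    (hI : ∀ a b, P.IsElementary a b → (I a b).Nonempty) :
    IsAllocation (P.symmetricShares I) := by
  have hmem : ∀ i x, x ∈ P.symmetricShares I i ↔ ∃ a b, P.IsElementary a b ∧ i ∈ I a b ∧
      ∃ m, (m = ((I a b).filter (· < i)).card ∨
        m = 2 * (I a b).card - 1 - ((I a b).filter (· < i)).card) ∧
        x ∈ part a b (I a b).card m := by
    intro i x
    simp only [symmetricShares, mem_ofPred_eq, mem_union, or_and_right, exists_or, exists_eq_left]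
  have hlt : ∀ {a b i m}, i ∈ I a b → (m = ((I a b).filter (· < i)).card ∨
      m = 2 * (I a b).card - 1 - ((I a b).filter (· < i)).card) → m < 2 * (I a b).card := by
    intro a b i m hi hm
    have := card_filter_lt_lt_card hi
    omega
  refine ⟨fun i => ?_, ?_, ?_⟩
  · refine ⟨{S | ∃ a b, P.IsElementary a b ∧ i ∈ I a b ∧
      ∃ m, (m = ((I a b).filter (· < i)).card ∨
        m = 2 * (I a b).card - 1 - ((I a b).filter (· < i)).card) ∧
        S = part a b (I a b).card m}, ?_, ?_, ?_, ?_⟩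
    · refine (P.finite_setOf_isElementary.biUnion (t := fun q =>
        {part q.1 q.2 (I q.1 q.2).card ((I q.1 q.2).filter (· < i)).card,
         part q.1 q.2 (I q.1 q.2).card
          (2 * (I q.1 q.2).card - 1 - ((I q.1 q.2).filter (· < i)).card)})
        fun q _ => toFinite _).subset ?_
      rintro S ⟨a, b, hab, -, m, hm | hm, rfl⟩
      · exact mem_biUnion (x := (a, b)) hab (Or.inl (by rw [hm]))
      · exact mem_biUnion (x := (a, b)) hab (Or.inr (by rw [hm]; rfl))
    · rintro S ⟨a, b, hab, hi, m, hm, rfl⟩ S' ⟨a', b', hab', hi', m', hm', rfl⟩ hne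
      refine P.disjoint_part hab hab' (fun a b => (I a b).card) (hlt hi hm) (hlt hi' hm') ?_
      rintro ⟨rfl, rfl, rfl⟩
      exact hne rfl
    · rintro S ⟨a, b, hab, hi, m, hm, rfl⟩
      exact ⟨ordConnected_part _ _ _ _,
        (part_subset hab.2.2.1 (hlt hi hm)).trans hab.Icc_subset⟩
    · ext x
      rw [hmem]
      constructor
      · rintro ⟨a, b, hab, hi, m, hm, hx⟩
        exact ⟨_, ⟨a, b, hab, hi, m, hm, rfl⟩, hx⟩
      · rintro ⟨S, ⟨a, b, hab, hi, m, hm, rfl⟩, hx⟩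
        exact ⟨a, b, hab, hi, m, hm, hx⟩
  · intro i j hij
    refine Set.disjoint_left.2 fun x hx hx' => ?_
    rw [hmem] at hx hx'
    obtain ⟨a, b, hab, hi, m, hm, hx⟩ := hx
    obtain ⟨a', b', hab', hj, m', hm', hx'⟩ := hx'
    by_cases heq : a = a' ∧ b = b' ∧ m = m'
    · obtain ⟨rfl, rfl, rfl⟩ := heq
      have h1 := card_filter_lt_lt_card hi
      have h2 := card_filter_lt_lt_card hj
      exact hij (card_filter_lt_injOn (I a b) hi hj (by simp only; omega))
    · exact Set.disjoint_left.1 (P.disjoint_part hab hab' (fun a b => (I a b).card)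
        (hlt hi hm) (hlt hj hm') heq) hx hx'
  · refine Subset.antisymm (iUnion_subset fun i x hx => ?_) fun x hx => ?_
    · obtain ⟨a, b, hab, hi, m, hm, hx⟩ := (hmem i x).1 hx
      exact hab.Icc_subset (part_subset hab.2.2.1 (hlt hi hm) hx)
    · have hpart : ∃ a b, P.IsElementary a b ∧ ∃ m < 2 * (I a b).card,
          x ∈ part a b (I a b).card m := by
        rcases hx.1.eq_or_lt with rfl | h0
        · obtain ⟨b, hb⟩ := P.exists_isElementary_zero
          exact ⟨0, b, hb, 0, by have := (hI 0 b hb).card_pos; omega,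
            zero_mem_part b hb.2.2.1 _⟩
        · obtain ⟨a, b, hab, hxab⟩ := P.exists_isElementary_mem ⟨h0, hx.2⟩
          exact ⟨a, b, hab, exists_mem_part hab.2.2.1 (hI a b hab).card_pos hxab⟩
      obtain ⟨a, b, hab, m, hm, hxm⟩ := hpart
      rw [mem_iUnion]
      rcases lt_or_ge m (I a b).card with h | h
      · obtain ⟨i, hi, hr⟩ := exists_card_filter_lt_eq h
        exact ⟨i, (hmem i x).2 ⟨a, b, hab, hi, m, Or.inl hr.symm, hxm⟩⟩
      · obtain ⟨i, hi, hr⟩ := exists_card_filter_lt_eq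
          (show 2 * (I a b).card - 1 - m < (I a b).card by omega)
        exact ⟨i, (hmem i x).2 ⟨a, b, hab, hi, m, Or.inr (by omega), hxm⟩⟩

/-- Agent `j` gets, in the eyes of every agent `i`, the fraction `1 / |I a b|` of each elementary
piece `[a, b]` in which they take part. -/
lemma value_symmetricShares (I : ℝ → ℝ → Finset (Fin n)) (i j : Fin n) :
    P.value i (P.symmetricShares I j) = ∑ q ∈ P.elementaryPieces,
      if j ∈ I q.1 q.2 then P.value i (Ioc q.1 q.2) / (I q.1 q.2).card else 0 := by
  set r : ℝ × ℝ → ℕ := fun q => ((I q.1 q.2).filter (· < j)).card with hr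
  set A : ℝ × ℝ → Set ℝ := fun q => part q.1 q.2 (I q.1 q.2).card (r q) with hA
  set B : ℝ × ℝ → Set ℝ :=
    fun q => part q.1 q.2 (I q.1 q.2).card (2 * (I q.1 q.2).card - 1 - r q) with hB
  have hunion : P.symmetricShares I j =
      ⋃ q ∈ P.elementaryPieces.filter (fun q => j ∈ I q.1 q.2), (A q ∪ B q) := by
    ext x
    simp only [symmetricShares, mem_ofPred_eq, mem_iUnion, Finset.mem_filter,
      mem_elementaryPieces, exists_prop, Prod.exists, and_assoc, hA, hB, hr]
  have hrlt : ∀ q : ℝ × ℝ, j ∈ I q.1 q.2 → r q < (I q.1 q.2).card :=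
    fun q hq => card_filter_lt_lt_card hq
  have hdisj : ∀ q q' : ℝ × ℝ, ∀ m m', P.IsElementary q.1 q.2 → P.IsElementary q'.1 q'.2 →
      m < 2 * (I q.1 q.2).card → m' < 2 * (I q'.1 q'.2).card → (q = q' → m ≠ m') →
      Disjoint (part q.1 q.2 (I q.1 q.2).card m) (part q'.1 q'.2 (I q'.1 q'.2).card m') :=
    fun q q' m m' hq hq' hm hm' hne => P.disjoint_part hq hq' (fun a b => (I a b).card) hm hm'
      fun h => hne (Prod.ext h.1 h.2.1) h.2.2
  have hsub : ∀ q : ℝ × ℝ, P.IsElementary q.1 q.2 → j ∈ I q.1 q.2 →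
      A q ⊆ Icc 0 1 ∧ B q ⊆ Icc 0 1 := by
    intro q hq hj
    have := hrlt q hj
    exact ⟨(part_subset hq.2.2.1 (by omega)).trans hq.Icc_subset,
      (part_subset hq.2.2.1 (by omega)).trans hq.Icc_subset⟩
  have hmeas : ∀ q, MeasurableSet (A q) ∧ MeasurableSet (B q) := fun q =>
    ⟨(ordConnected_part _ _ _ _).measurableSet, (ordConnected_part _ _ _ _).measurableSet⟩
  rw [hunion, ← Finset.sum_filter]
  refine (integral_biUnion_finset _ (fun q _ => (hmeas q).1.union (hmeas q).2) ?_ ?_).trans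
    (Finset.sum_congr rfl fun q hq => ?_)
  · intro q hq q' hq' hne
    rw [Finset.mem_coe, Finset.mem_filter, mem_elementaryPieces] at hq hq'
    have h1 := hrlt q hq.2
    have h2 := hrlt q' hq'.2
    change Disjoint (A q ∪ B q) (A q' ∪ B q')
    simp only [disjoint_union_left, disjoint_union_right]
    refine ⟨⟨?_, ?_⟩, ?_, ?_⟩ <;>
      exact hdisj _ _ _ _ hq.1 hq'.1 (by omega) (by omega) fun h => absurd h hne
  · intro q hq
    rw [Finset.mem_filter, mem_elementaryPieces] at hq
    exact P.integrableOn_density i (union_subset (hsub q hq.1 hq.2).1 (hsub q hq.1 hq.2).2)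
  · rw [Finset.mem_filter, mem_elementaryPieces] at hq
    have h1 := hrlt q hq.2
    rw [← P.value_part_add_value_part hq.1 i h1]
    refine P.value_union i (hsub q hq.1 hq.2).1 (hsub q hq.1 hq.2).2 (hmeas q).2 ?_
    exact hdisj _ _ _ _ hq.1 hq.1 (by omega) (by omega) fun _ => by omega

/-! ### The Wang–Wu mechanisms -/

lemma isAllocation_wangWu : IsAllocation P.wangWu :=
  P.isAllocation_symmetricShares fun _ _ _ => ⟨⟨0, P.numAgents_pos⟩, Finset.mem_univ _⟩

lemma value_wangWu_eq_sum (i j : Fin n) :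
    P.value i (P.wangWu j) = ∑ q ∈ P.elementaryPieces, P.value i (Ioc q.1 q.2) / n := by
  simp [wangWu, value_symmetricShares]

lemma value_wangWu (i j : Fin n) : P.value i (P.wangWu j) = 1 / n := by
  rw [value_wangWu_eq_sum, ← Finset.sum_div, sum_value_elementaryPieces]

lemma isEnvyFree_modifiedWangWu : P.IsEnvyFree P.modifiedWangWu := by
  refine ⟨P.isAllocation_symmetricShares fun _ _ h => h.interested_nonempty, fun i j => ?_⟩
  rw [modifiedWangWu, value_symmetricShares, value_symmetricShares]
  refine Finset.sum_le_sum fun q hq => ?_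
  rw [mem_elementaryPieces] at hq
  by_cases hi : i ∈ P.interested q.1 q.2
  · rw [if_pos hi]
    split_ifs
    exacts [le_rfl, div_nonneg (P.value_nonneg _ _) (Nat.cast_nonneg _)]
  · rw [if_neg hi, hq.value_eq_zero hi, zero_div, ite_self]

lemma value_div_le_ite {i : Fin n} {q : ℝ × ℝ} (hq : P.IsElementary q.1 q.2) :
    P.value i (Ioc q.1 q.2) / n ≤ if i ∈ P.interested q.1 q.2 then
      P.value i (Ioc q.1 q.2) / (P.interested q.1 q.2).card else 0 := by
  split_ifs with hi
  · refine div_le_div_of_nonneg_left (P.value_nonneg _ _) ?_ ?_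
    · exact Nat.cast_pos.2 (Finset.card_pos.2 ⟨i, hi⟩)
    · exact Nat.cast_le.2 (by simpa using Finset.card_le_univ (P.interested q.1 q.2))
  · rw [hq.value_eq_zero hi, zero_div]

lemma weaklyDominates_modifiedWangWu : P.WeaklyDominates P.modifiedWangWu P.wangWu := by
  intro i
  rw [value_wangWu_eq_sum, modifiedWangWu, value_symmetricShares]
  exact Finset.sum_le_sum fun q hq => P.value_div_le_ite (P.mem_elementaryPieces.1 hq)

/-- If some agent has no value for an elementary piece, those who have share it among fewer. -/
lemma paretoDominates_modifiedWangWu {a b : ℝ} (h : P.IsElementary a b) {i : Fin n}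
    (hi : i ∉ P.interested a b) : P.ParetoDominates P.modifiedWangWu P.wangWu := by
  refine ⟨P.weaklyDominates_modifiedWangWu, ?_⟩
  obtain ⟨j, hj⟩ := h.interested_nonempty
  refine ⟨j, ?_⟩
  rw [value_wangWu_eq_sum, modifiedWangWu, value_symmetricShares]
  refine Finset.sum_lt_sum (fun q hq => P.value_div_le_ite (P.mem_elementaryPieces.1 hq))
    ⟨(a, b), P.mem_elementaryPieces.2 h, ?_⟩
  rw [if_pos hj]
  refine div_lt_div_of_pos_left (h.value_pos hj) ?_ ?_
  · exact Nat.cast_pos.2 (Finset.card_pos.2 ⟨j, hj⟩)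
  · refine Nat.cast_lt.2 ?_
    simpa using Finset.card_lt_univ_of_notMem hi

lemma paretoDominates_modifiedWangWu_iff :
    P.ParetoDominates P.modifiedWangWu P.wangWu ↔ ∃ i, 0 < P.left i ∨ P.right i < 1 := by
  constructor
  · rintro ⟨-, i, hi⟩
    by_contra! hcon
    refine hi.ne ?_
    rw [value_wangWu_eq_sum, modifiedWangWu, value_symmetricShares]
    refine Finset.sum_congr rfl fun q hq => ?_
    rw [mem_elementaryPieces] at hq
    have hall : P.interested q.1 q.2 = Finset.univ := Finset.eq_univ_of_forall fun j =>
      hq.mem_interested_iff.2 ⟨(hcon j).1.trans hq.nonneg, hq.le_one.trans (hcon j).2⟩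
    simp [hall]
  · rintro ⟨i, hi | hi⟩
    · obtain ⟨b, hb⟩ := P.exists_isElementary_zero
      refine P.paretoDominates_modifiedWangWu hb (i := i) fun h => ?_
      exact absurd (hb.mem_interested_iff.1 h).1 (not_le.2 hi)
    · obtain ⟨a, b, hab, hx⟩ := P.exists_isElementary_mem (right_mem_Ioc.2 one_pos)
      refine P.paretoDominates_modifiedWangWu hab (i := i) fun h => ?_
      exact absurd (hx.2.trans (hab.mem_interested_iff.1 h).2) (not_le.2 hi)

lemma IsLeftmostLeavesCuts.paretoDominates_wangWu {P : CakeProblem n}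
    (hslope : ∀ i j, P.slope i = P.slope j) (hpeak : Function.Injective P.peak)
    {c : Fin (n + 1) → ℝ} (h : P.IsLeftmostLeavesCuts c) (hn : 2 ≤ n) :
    P.ParetoDominates (P.peakPreserving c) P.wangWu := by
  refine ⟨fun i => ?_, P.byPeak ⟨1, hn⟩, ?_⟩
  · obtain ⟨m, rfl⟩ := P.byPeak.surjective i
    rw [value_wangWu]
    exact (h.inv_le_value hslope hpeak m).1
  · rw [value_wangWu]
    exact (h.inv_le_value hslope hpeak ⟨1, hn⟩).2 one_pos

end CakeProblem

theorem proposition3 {n : ℕ} (P : CakeProblem n)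
    (hslope : ∀ i j, P.slope i = P.slope j)
    (hpeak : Function.Injective P.peak) :
    ((∃! c, P.IsUtilitarianCuts c) ∧
      ∀ c, P.IsUtilitarianCuts c →
        P.IsParetoOptimal (P.peakPreserving c) ∧
        P.MaximizesTotalUtility (P.peakPreserving c)) ∧
    IsAllocation P.wangWu ∧
    ((∃! c, P.IsLeftmostLeavesCuts c) ∧
      ∀ c, P.IsLeftmostLeavesCuts c →
        P.IsParetoOptimal (P.peakPreserving c) ∧
        (2 ≤ n → P.ParetoDominates (P.peakPreserving c) P.wangWu)) ∧
    (P.IsEnvyFree P.modifiedWangWu ∧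
      P.WeaklyDominates P.modifiedWangWu P.wangWu ∧
      (P.ParetoDominates P.modifiedWangWu P.wangWu ↔
        ∃ i, 0 < P.left i ∨ P.right i < 1)) := by
  refine ⟨⟨P.existsUnique_isUtilitarianCuts hslope hpeak, fun c hc => ?_⟩, P.isAllocation_wangWu,
    ⟨existsUnique_of_exists_of_unique (CakeProblem.exists_isLeftmostLeavesCuts hslope hpeak)
      fun c c' h h' => h.unique hslope hpeak h',
      fun c hc => ⟨hc.isParetoOptimal hslope hpeak, hc.paretoDominates_wangWu hslope hpeak⟩⟩,
    P.isEnvyFree_modifiedWangWu, P.weaklyDominates_modifiedWangWu,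
    P.paretoDominates_modifiedWangWu_iff⟩
  have hmax := P.maximizesTotalUtility_of_isUtilitarianCuts hslope hpeak hc
  exact ⟨hmax.isParetoOptimal, hmax⟩
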